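/- Let $s>\frac12$. For $\sigma\in\mathbb R$ and $u\in\mathcal S'=\mathcal S'(\mathbb R;\mathbb C)$ put $\|u\|_{H^\sigma}=\|(1+|\xi|^2)^{\sigma/2}\,\widehat u\,\|_{L^2(\mathbb R)}$, with the unitary Fourier transform $\widehat u(\xi)=(2\pi)^{-1/2}\int_{\mathbb R}e^{-ix\xi}u(x)\,dx$; norms take the value $+\infty$ when $u$ is not in the respective space, and $0\cdot\infty=0$. The product $fg$ of $f,g\in\mathcal S'$ is the limit in $\mathcal S'$ of the products of smooth functions $(S_jf)(S_jg)$ as $j\to\infty$, where $\widehat{S_ju}=\chi(2^{-j}\cdot)\,\widehat u$ and $\chi\in C_c^\infty(\mathbb R;\mathbb R)$ equals $1$ near $0$; the product is said to exist if the limit exists for every such $\chi$ and does not depend on $\chi$. There exists a finite constant $C=C(s)$ such that for all $f,g\in\mathcal S'$ the following holds. 1. If $f\in L^\infty$, $f'\in H^{s-1}$ and $g\in H^s\cup H^{s-1}$, then the product $fg$ exists. 2. Whenever the product $fg$ exists, $$\|fg\|_{H^s}\le C(s)\,\|g\|_{H^s}\big(\|f\|_{L^\infty}+\|f'\|_{H^{s-1}}\big)$$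 and $$\|fg\|_{H^{s-1}}\le C(s)\,\|g\|_{H^{s-1}}\big(\|f\|_{L^\infty}+\|f'\|_{H^{s-1}}\big).$$ -/

import Mathlib

open MeasureTheory Filter Topology
open scoped SchwartzMap FourierTransform ENNReal NNReal ContDiff

noncomputable section

namespace ProductEstimate

/-- The weight `⟨2πξ⟩ ^ s = (1 + (2πξ)²) ^ (s/2)`. Mathlib's Fourier transform
`𝓕 f ξ = ∫ exp (-2πi x ξ) f x dx` is related to the unitary one,
`f̂ ξ = (2π)^(-1/2) ∫ exp (-i x ξ) f x dx`, by `f̂ ξ = (2π)^(-1/2) 𝓕 f (ξ / 2π)`; so the weight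
`⟨ξ⟩ ^ s` in front of `f̂` becomes `⟨2πξ⟩ ^ s` in front of `𝓕 f`, with the same `L²` norm. -/
def weight (s : ℝ) (ξ : ℝ) : ℂ :=
  (((1 + ‖2 * Real.pi * ξ‖ ^ 2) ^ (s / 2) : ℝ) : ℂ)

/-- The weight has temperate growth, so multiplying a tempered distribution by it (`smulLeftCLM`)
is the genuine multiplication. -/
theorem weight_hasTemperateGrowth (s : ℝ) : (weight s).HasTemperateGrowth := by
  have h1 : (fun ξ : ℝ ↦ 2 * Real.pi * ξ).HasTemperateGrowth := by fun_prop
  have h2 := (Function.hasTemperateGrowth_one_add_norm_sq_rpow ℝ (s / 2)).comp h1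
  unfold weight
  fun_prop

/-- The norm `‖f‖_{H^s} = ‖⟨ξ⟩ ^ s f̂‖_{L²}` of a tempered distribution on `ℝ`, with value `∞` if
`⟨ξ⟩ ^ s f̂` is not (given by) an `L²` function. -/
def sobolevNorm (s : ℝ) (f : 𝓢'(ℝ, ℂ)) : ℝ≥0∞ :=
  ⨅ (u : Lp ℂ 2 (volume : Measure ℝ))
    (_ : TemperedDistribution.smulLeftCLM ℂ (weight s) (𝓕 f) = (u : 𝓢'(ℝ, ℂ))), ‖u‖ₑ

/-- The `L^∞` norm of a tempered distribution on `ℝ`, with value `∞` if the distribution is not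
(given by) an essentially bounded function. -/
def supNorm (f : 𝓢'(ℝ, ℂ)) : ℝ≥0∞ :=
  ⨅ (u : Lp ℂ ∞ (volume : Measure ℝ)) (_ : f = (u : 𝓢'(ℝ, ℂ))), ‖u‖ₑ

/-- A frequency cutoff: a smooth compactly supported function equal to one near zero. -/
structure IsCutoff (χ : ℝ → ℝ) : Prop where
  smooth : ContDiff ℝ ∞ χ
  compact : HasCompactSupport χ
  eq_one : χ =ᶠ[𝓝 0] 1

/-- The function `ξ ↦ χ (2^{-j} ξ) exp (2πi x ξ)`. -/
def kernelFun (χ : ℝ → ℝ) (j : ℕ) (x ξ : ℝ) : ℂ :=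
  (χ ((2 ^ j : ℝ)⁻¹ * ξ) : ℂ) * Complex.exp (2 * Real.pi * Complex.I * x * ξ)

theorem IsCutoff.contDiff_kernelFun {χ : ℝ → ℝ} (hχ : IsCutoff χ) (j : ℕ) (x : ℝ) :
    ContDiff ℝ ∞ (kernelFun χ j x) := by
  have h1 : ContDiff ℝ ∞ (fun ξ : ℝ ↦ χ ((2 ^ j : ℝ)⁻¹ * ξ)) :=
    hχ.smooth.comp (by fun_prop)
  have h2 : ContDiff ℝ ∞ (fun ξ : ℝ ↦ ((χ ((2 ^ j : ℝ)⁻¹ * ξ) : ℝ) : ℂ)) :=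
    Complex.ofRealCLM.contDiff.comp h1
  have h3 : ContDiff ℝ ∞ (fun ξ : ℝ ↦ (ξ : ℂ)) := Complex.ofRealCLM.contDiff
  exact h2.mul (Complex.contDiff_exp.comp (contDiff_const.mul h3))

theorem IsCutoff.hasCompactSupport_kernelFun {χ : ℝ → ℝ} (hχ : IsCutoff χ) (j : ℕ) (x : ℝ) :
    HasCompactSupport (kernelFun χ j x) := by
  have h0 : ((2 ^ j : ℝ)⁻¹) ≠ 0 := by positivity
  have h1 : HasCompactSupport (fun ξ : ℝ ↦ χ ((2 ^ j : ℝ)⁻¹ * ξ)) :=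
    hχ.compact.comp_homeomorph (Homeomorph.mulLeft₀ _ h0)
  have h2 : HasCompactSupport (fun ξ : ℝ ↦ ((χ ((2 ^ j : ℝ)⁻¹ * ξ) : ℝ) : ℂ)) :=
    h1.comp_left (g := fun r : ℝ ↦ (r : ℂ)) Complex.ofReal_zero
  exact h2.mul_right

/-- The low-frequency part `S_j f = χ (2^{-j} D) f` of a tempered distribution `f`. Its Fourier
transform `χ (2^{-j} ·) 𝓕 f` has compact support, hence `S_j f` is the smooth function of
polynomial growth `x ↦ ⟨𝓕 f, χ (2^{-j} ·) exp (2πi x ·)⟩`. If `χ + ∑_{j ≥ 0} φ (2^{-j} ·) = 1` is a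
dyadic partition of unity, this is the partial sum `∑_{j' < j} Δ_{j'} f` of the Littlewood-Paley
blocks. -/
def lowFreq {χ : ℝ → ℝ} (hχ : IsCutoff χ) (j : ℕ) (f : 𝓢'(ℝ, ℂ)) (x : ℝ) : ℂ :=
  (𝓕 f) ((hχ.hasCompactSupport_kernelFun j x).toSchwartzMap (hχ.contDiff_kernelFun j x))

/-- `h` is the product of the tempered distributions `f` and `g`, i.e. the limit in `𝓢'` of the
products of smooth functions `S_j f * S_j g`, for every choice of the cutoff. (The integrand is a
smooth function of polynomial growth times a Schwartz function, so it is integrable.) -/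
def IsProduct (f g h : 𝓢'(ℝ, ℂ)) : Prop :=
  ∀ (χ : ℝ → ℝ) (hχ : IsCutoff χ) (φ : 𝓢(ℝ, ℂ)),
    Tendsto (fun j : ℕ ↦ ∫ x, lowFreq hχ j f x * lowFreq hχ j g x * φ x) atTop (𝓝 (h φ))

theorem exists_isCutoff : ∃ χ : ℝ → ℝ, IsCutoff χ := by
  let b : ContDiffBump (0 : ℝ) := ⟨1, 2, by norm_num, by norm_num⟩
  exact ⟨b, b.contDiff, b.hasCompactSupport, b.eventuallyEq_one⟩

/-- There is at most one product. -/
theorem IsProduct.unique {f g h h' : 𝓢'(ℝ, ℂ)} (H : IsProduct f g h) (H' : IsProduct f g h') :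
    h = h' := by
  obtain ⟨χ, hχ⟩ := exists_isCutoff
  ext φ
  exact tendsto_nhds_unique (H χ hχ φ) (H' χ hχ φ)

end ProductEstimate

end

/-! The idea is that `f'` in `H^{s-1}` controls every frequency of `f` away from zero, while
boundedness of `f` takes care of the frequencies near zero. Fix one cutoff `χ₀` vanishing for `|ξ| ≥
1`. Then `S_j f = f₀ + F_j`, where `f₀ = χ₀(D) f` depends neither on `χ` nor on `j`, and the
transform of `F_j` is `(χ(2^{-j} ξ) - χ₀(ξ)) / (2πiξ)` times that of `f'`. The numerator vanishes
near zero, so the quotient is `O(⟨ξ⟩^{-1})` uniformly in `j` and `F_j` is bounded in `H^s`.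

High part: `H^s · H^σ ⊆ H^σ` for `|σ| ≤ s`, `s > 1/2`. Tested against `𝓕 Φ`, the product becomes an
absolutely convergent double integral containing `Φ (ξ + η)`. Its weight is dominated by `⟨ξ⟩^{-s} +
⟨η⟩^{-s} + ⟨ξ+η⟩^{-s}` (`wt_kernel_le`), each term is in `L²`, and Cauchy-Schwarz concludes
(`exists_lintegral_kernel_le`). The limit in `j` is dominated convergence (`exists_high_limit`).

Low part: multiplication by the bounded function `f₀` moves frequencies by less than one, and over
such distances the weight is comparable to a constant. Cutting the other factor into unit frequency
bands and using Plancherel on each band, with bounded overlap, shows boundedness on `H^σ` for every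
real `σ` (`exists_lowPass_bound`). Since `𝓕 f₀` is only a distribution, the limit comes from a
Cauchy estimate in the truncation error (`exists_low_limit`).

The limit is a linear functional bounded in the norm dual to `H^σ`, hence by Riesz an element of
`H^σ` (`exists_sobolevNorm_le_of_bound`). The two claims are the cases `σ = s` and `σ = s - 1`. -/

noncomputable section

namespace ProductEstimate

/-! ### Inequalities for the Sobolev weight -/

/-- The real-valued weight `(1 + (2πx)²) ^ (σ/2)`. -/
def wt (σ x : ℝ) : ℝ := (1 + ‖2 * Real.pi * x‖ ^ 2) ^ (σ / 2)

theorem weight_eq (σ x : ℝ) : weight σ x = (wt σ x : ℂ) := rfl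

theorem base_pos (x : ℝ) : 0 < 1 + ‖2 * Real.pi * x‖ ^ 2 := by positivity

theorem wt_pos (σ x : ℝ) : 0 < wt σ x := Real.rpow_pos_of_pos (base_pos x) _

theorem wt_add (a b x : ℝ) : wt (a + b) x = wt a x * wt b x := by
  rw [wt, wt, wt, add_div, Real.rpow_add (base_pos x)]

theorem wt_zero (x : ℝ) : wt 0 x = 1 := by simp [wt]

theorem wt_mul_wt_neg (σ x : ℝ) : wt σ x * wt (-σ) x = 1 := by
  rw [← wt_add, add_neg_cancel, wt_zero]

theorem wt_neg_mul_wt (σ x : ℝ) : wt (-σ) x * wt σ x = 1 := by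
  rw [mul_comm, wt_mul_wt_neg]

theorem continuous_wt (σ : ℝ) : Continuous (wt σ) := by
  unfold wt
  exact Continuous.rpow_const (by fun_prop) fun x => Or.inl (base_pos x).ne'

theorem measurable_wt (σ : ℝ) : Measurable (wt σ) := (continuous_wt σ).measurable

/-- Peetre-type inequality for nonnegative exponents. -/
theorem wt_add_le {σ : ℝ} (hσ : 0 ≤ σ) (x y : ℝ) :
    wt σ (x + y) ≤ 4 ^ (σ / 2) * (wt σ x + wt σ y) := by
  -- The summand of larger modulus dominates: `|u + v|² ≤ 4 |v|²`, whence the factor `4 ^ (σ / 2)`.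
  have key : ∀ u v : ℝ, ‖2 * Real.pi * u‖ ^ 2 ≤ ‖2 * Real.pi * v‖ ^ 2 →
      wt σ (u + v) ≤ 4 ^ (σ / 2) * wt σ v := by
    intro u v huv
    rw [wt, wt, ← Real.mul_rpow (by norm_num) (base_pos v).le]
    apply Real.rpow_le_rpow (base_pos _).le _ (by linarith)
    simp only [Real.norm_eq_abs, sq_abs] at *
    nlinarith [sq_nonneg (2 * Real.pi * u - 2 * Real.pi * v)]
  rw [mul_add]
  have p1 : 0 ≤ (4 : ℝ) ^ (σ / 2) * wt σ x := by have := wt_pos σ x; positivity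
  have p2 : 0 ≤ (4 : ℝ) ^ (σ / 2) * wt σ y := by have := wt_pos σ y; positivity
  rcases le_total (‖2 * Real.pi * x‖ ^ 2) (‖2 * Real.pi * y‖ ^ 2) with h | h
  · linarith [key x y h]
  · rw [add_comm x y]
    linarith [key y x h]

/-- Negative powers of the weight decrease in the modulus, so both factors may be evaluated at the
point of smaller modulus, where the exponents add up. -/
theorem wt_neg_mul_wt_neg_le {α β : ℝ} (hα : 0 ≤ α) (hβ : 0 ≤ β) (x y : ℝ) :
    wt (-α) x * wt (-β) y ≤ wt (-(α + β)) x + wt (-(α + β)) y := by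
  have mono : ∀ {γ : ℝ}, 0 ≤ γ → ∀ u v : ℝ, ‖2 * Real.pi * u‖ ^ 2 ≤ ‖2 * Real.pi * v‖ ^ 2 →
      wt (-γ) v ≤ wt (-γ) u := by
    intro γ hγ u v huv
    exact Real.rpow_le_rpow_of_nonpos (base_pos u) (by linarith) (by linarith)
  rcases le_total (‖2 * Real.pi * x‖ ^ 2) (‖2 * Real.pi * y‖ ^ 2) with h | h
  · have : wt (-(α + β)) x = wt (-α) x * wt (-β) x := by rw [← wt_add]; congr 1; ring
    have h2 := mul_le_mul_of_nonneg_left (mono hβ x y h) (wt_pos (-α) x).le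
    linarith [wt_pos (-(α + β)) y]
  · have : wt (-(α + β)) y = wt (-α) y * wt (-β) y := by rw [← wt_add]; congr 1; ring
    have h2 := mul_le_mul_of_nonneg_right (mono hα y x h) (wt_pos (-β) y).le
    linarith [wt_pos (-(α + β)) x]

/-- The kernel of the product `H^s × H^σ → H^σ` on the Fourier side. -/
theorem wt_kernel_le {s σ : ℝ} (h : |σ| ≤ s) (x y : ℝ) :
    wt (-s) x * wt (-σ) y * wt σ (x + y) ≤
      2 * 4 ^ (s / 2) * (wt (-s) x + wt (-s) y + wt (-s) (x + y)) := by
  have hs : 0 ≤ s := (abs_nonneg σ).trans h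
  -- The point `z` enters only through the Peetre bound. The same computation thus serves `σ ≥ 0`
  -- with `z = x + y`, and `σ ≤ 0` with `y` and `x + y` interchanged.
  have key : ∀ τ : ℝ, 0 ≤ τ → τ ≤ s → ∀ x y z : ℝ, wt τ z ≤ 4 ^ (τ / 2) * (wt τ x + wt τ y) →
      wt (-s) x * wt (-τ) y * wt τ z ≤ 2 * 4 ^ (s / 2) * (wt (-s) x + wt (-s) y) := by
    intro τ h0 h1 x y z hz
    have e1 : wt (-s) x * wt (-τ) y * (wt τ x + wt τ y) =
        wt (-(s - τ)) x * wt (-τ) y + wt (-s) x := by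
      rw [mul_add, mul_assoc (wt (-s) x) (wt (-τ) y) (wt τ y), wt_neg_mul_wt, mul_one]
      have : wt (-(s - τ)) x = wt (-s) x * wt τ x := by rw [← wt_add]; congr 1; ring
      rw [this]; ring
    have e2 := wt_neg_mul_wt_neg_le (sub_nonneg.2 h1) h0 x y
    rw [sub_add_cancel] at e2
    have e3 : (4 : ℝ) ^ (τ / 2) ≤ 4 ^ (s / 2) :=
      Real.rpow_le_rpow_of_exponent_le (by norm_num) (by linarith)
    have px := wt_pos (-s) x
    have py := wt_pos (-s) y
    have py' := wt_pos (-τ) y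
    calc wt (-s) x * wt (-τ) y * wt τ z
        ≤ wt (-s) x * wt (-τ) y * (4 ^ (τ / 2) * (wt τ x + wt τ y)) := by gcongr
      _ = 4 ^ (τ / 2) * (wt (-(s - τ)) x * wt (-τ) y + wt (-s) x) := by rw [← e1]; ring
      _ ≤ 4 ^ (s / 2) * (2 * (wt (-s) x + wt (-s) y)) := by
          apply mul_le_mul e3 (by linarith) _ (by positivity)
          have := wt_pos (-(s - τ)) x
          positivity
      _ = _ := by ring
  have p : (0 : ℝ) < 2 * 4 ^ (s / 2) := by positivity
  have px := mul_pos p (wt_pos (-s) x)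
  have py := mul_pos p (wt_pos (-s) y)
  have pz := mul_pos p (wt_pos (-s) (x + y))
  rcases le_total 0 σ with h0 | h0
  · rw [abs_of_nonneg h0] at h
    have := key σ h0 h x y (x + y) (wt_add_le h0 x y)
    nlinarith
  · rw [abs_of_nonpos h0] at h
    have hz : wt (-σ) y ≤ 4 ^ (-σ / 2) * (wt (-σ) x + wt (-σ) (x + y)) := by
      have := wt_add_le (neg_nonneg.2 h0) (-x) (x + y)
      have e : wt (-σ) (-x) = wt (-σ) x := by simp [wt]
      rwa [neg_add_cancel_left, e] at this
    have := key (-σ) (neg_nonneg.2 h0) h x (x + y) y hz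
    rw [neg_neg] at this
    nlinarith

/-- The weight varies slowly. -/
theorem exists_wt_le (σ : ℝ) : ∃ C : ℝ, 0 < C ∧ ∀ x y : ℝ, |x - y| ≤ 2 →
    wt σ x ≤ C * wt σ y := by
  -- From `x² ≤ 2y² + 8` one gets `1 + 4π²x² ≤ (1 + 32π²) + 8π²y²`, which `A` absorbs.
  set A : ℝ := 2 + 32 * Real.pi ^ 2 with hA
  have hA1 : 1 ≤ A := by nlinarith [sq_nonneg Real.pi]
  have key : ∀ x y : ℝ, |x - y| ≤ 2 →
      1 + ‖2 * Real.pi * x‖ ^ 2 ≤ A * (1 + ‖2 * Real.pi * y‖ ^ 2) := by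
    intro x y h
    simp only [Real.norm_eq_abs, sq_abs]
    have h1 : (x - y) ^ 2 ≤ 4 := by
      have := abs_le.1 h
      nlinarith
    have h2 : x ^ 2 ≤ 2 * y ^ 2 + 8 := by nlinarith [sq_nonneg (x - 2 * y)]
    have h3 : 0 ≤ Real.pi ^ 2 := sq_nonneg _
    have h4 : Real.pi ^ 2 * x ^ 2 ≤ Real.pi ^ 2 * (2 * y ^ 2 + 8) :=
      mul_le_mul_of_nonneg_left h2 h3
    have h5 : 0 ≤ Real.pi ^ 2 * (Real.pi ^ 2 * y ^ 2) := by positivity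
    rw [hA]
    nlinarith
  refine ⟨A ^ (|σ| / 2), by positivity, fun x y h => ?_⟩
  rcases le_total 0 σ with h0 | h0
  · rw [abs_of_nonneg h0, wt, wt, ← Real.mul_rpow (by linarith) (base_pos y).le]
    exact Real.rpow_le_rpow (base_pos _).le (key x y h) (by linarith)
  · have h1 : wt (-σ) y ≤ A ^ (|σ| / 2) * wt (-σ) x := by
      rw [abs_of_nonpos h0, wt, wt, ← Real.mul_rpow (by linarith) (base_pos x).le]
      exact Real.rpow_le_rpow (base_pos _).le (key y x (by rwa [abs_sub_comm])) (by linarith)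
    have px := wt_pos σ x
    have py := wt_pos σ y
    calc wt σ x = wt σ x * (wt (-σ) y * wt σ y) := by rw [wt_neg_mul_wt, mul_one]
      _ ≤ wt σ x * (A ^ (|σ| / 2) * wt (-σ) x * wt σ y) := by gcongr
      _ = A ^ (|σ| / 2) * wt σ y * (wt σ x * wt (-σ) x) := by ring
      _ = _ := by rw [wt_mul_wt_neg, mul_one]

/-! ### The trilinear estimate on the Fourier side -/

/-- The `L²` norm of a nonnegative function. -/
def l2 (f : ℝ → ℝ≥0∞) : ℝ≥0∞ := (∫⁻ x, f x ^ (2 : ℝ)) ^ (1 / 2 : ℝ)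

/-- This is where `s > 1/2` enters: `⟨ξ⟩^{-2s}` is integrable on the line exactly when `2s > 1`. -/
theorem l2_wt_lt_top {s : ℝ} (hs : 1 / 2 < s) : l2 (fun x => ENNReal.ofReal (wt (-s) x)) < ⊤ := by
  have h1 : Integrable (fun x : ℝ => (1 + ‖x‖ ^ 2) ^ (-(2 * s) / 2)) :=
    integrable_rpow_neg_one_add_norm_sq (by simp; linarith)
  apply ENNReal.rpow_lt_top_of_nonneg (by norm_num)
  refine (lt_of_le_of_lt (lintegral_mono fun x => ?_) h1.lintegral_lt_top).ne
  rw [ENNReal.ofReal_rpow_of_nonneg (wt_pos _ _).le (by norm_num)]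
  apply ENNReal.ofReal_le_ofReal
  rw [wt, ← Real.rpow_mul (base_pos x).le]
  have : -s / 2 * 2 = -(2 * s) / 2 := by ring
  rw [this]
  apply Real.rpow_le_rpow_of_nonpos (by positivity) _ (by linarith)
  simp only [Real.norm_eq_abs, sq_abs]
  have : 1 ≤ (2 * Real.pi) ^ 2 := by nlinarith [Real.pi_gt_three]
  nlinarith [sq_nonneg x, mul_le_mul_of_nonneg_right this (sq_nonneg x)]

theorem lintegral_mul_le_l2 {f g : ℝ → ℝ≥0∞} (hf : Measurable f) (hg : Measurable g) :
    ∫⁻ x, f x * g x ≤ l2 f * l2 g :=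
  ENNReal.lintegral_mul_le_Lp_mul_Lq volume Real.HolderConjugate.two_two hf.aemeasurable
    hg.aemeasurable

theorem l2_comp_add_left (f : ℝ → ℝ≥0∞) (x : ℝ) : l2 (fun y => f (x + y)) = l2 f := by
  unfold l2
  rw [lintegral_add_left_eq_self (fun y => f y ^ (2 : ℝ)) x]

theorem l2_mono {f g : ℝ → ℝ≥0∞} (h : ∀ x, f x ≤ g x) : l2 f ≤ l2 g := by
  unfold l2
  gcongr with x
  exact h x

theorem l2_const_mul {c : ℝ≥0∞} (hc : c ≠ ⊤) (f : ℝ → ℝ≥0∞) :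
    l2 (fun x => c * f x) = c * l2 f := by
  unfold l2
  simp_rw [ENNReal.mul_rpow_of_nonneg _ _ (by norm_num : (0 : ℝ) ≤ 2)]
  rw [lintegral_const_mul' _ _ (by finiteness), ENNReal.mul_rpow_of_nonneg _ _ (by norm_num),
    ← ENNReal.rpow_mul]
  norm_num

/-- Trilinear estimate with an `L²` weight in the outer variable. -/
theorem lintegral_lintegral_mul_le {w a b : ℝ → ℝ≥0∞} {c : ℝ → ℝ → ℝ≥0∞} {M : ℝ≥0∞}
    (hw : Measurable w) (ha : Measurable a) (hb : Measurable b)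
    (hc : ∀ x, Measurable (c x)) (hM : ∀ x, l2 (c x) ≤ M) :
    ∫⁻ x, ∫⁻ y, w x * (a x * b y * c x y) ≤ l2 w * l2 a * l2 b * M := by
  calc ∫⁻ x, ∫⁻ y, w x * (a x * b y * c x y)
      = ∫⁻ x, w x * a x * ∫⁻ y, b y * c x y := by
        congr 1 with x
        have h := lintegral_const_mul (μ := volume) (w x * a x) (hb.mul (hc x))
        simp only [Pi.mul_apply] at h
        rw [← h]
        congr 1 with y
        ring
    _ ≤ ∫⁻ x, w x * a x * (l2 b * M) := by
        gcongr with x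
        exact (lintegral_mul_le_l2 hb (hc x)).trans (by gcongr; exact hM x)
    _ = (∫⁻ x, w x * a x) * (l2 b * M) := lintegral_mul_const _ (hw.mul ha)
    _ ≤ l2 w * l2 a * (l2 b * M) := by
        gcongr
        exact lintegral_mul_le_l2 hw ha
    _ = _ := by ring

/-- The trilinear form of the product `H^s × H^σ → H^σ`, with general weights. -/
theorem lintegral_trilinear_le {w a b c : ℝ → ℝ≥0∞} (hw : Measurable w) (ha : Measurable a)
    (hb : Measurable b) (hc : Measurable c) :
    ∫⁻ x, ∫⁻ y, (w x + w y + w (x + y)) * (a x * b y * c (x + y)) ≤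
      3 * l2 w * (l2 a * l2 b * l2 c) := by
  have hwadd : Measurable fun p : ℝ × ℝ => w (p.1 + p.2) := hw.comp (by fun_prop)
  have hcadd : Measurable fun p : ℝ × ℝ => c (p.1 + p.2) := hc.comp (by fun_prop)
  have ma : Measurable fun p : ℝ × ℝ => a p.1 := ha.comp measurable_fst
  have mb : Measurable fun p : ℝ × ℝ => b p.2 := hb.comp measurable_snd
  have mw1 : Measurable fun p : ℝ × ℝ => w p.1 := hw.comp measurable_fst
  have mw2 : Measurable fun p : ℝ × ℝ => w p.2 := hw.comp measurable_snd
  have m1 : Measurable fun p : ℝ × ℝ => w p.1 * (a p.1 * b p.2 * c (p.1 + p.2)) := by fun_prop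
  have m2 : Measurable fun p : ℝ × ℝ => w p.2 * (a p.1 * b p.2 * c (p.1 + p.2)) := by fun_prop
  have m3 : Measurable fun p : ℝ × ℝ => w (p.1 + p.2) * (a p.1 * b p.2 * c (p.1 + p.2)) := by
    fun_prop
  have e1 : ∫⁻ x, ∫⁻ y, w x * (a x * b y * c (x + y)) ≤ l2 w * (l2 a * l2 b * l2 c) := by
    refine (lintegral_lintegral_mul_le hw ha hb (c := fun x y => c (x + y)) (M := l2 c)
      (fun x => hc.comp (measurable_const_add x)) fun x => (l2_comp_add_left c x).le).trans ?_
    exact (by ring : _ = _).le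
  have e2 : ∫⁻ x, ∫⁻ y, w y * (a x * b y * c (x + y)) ≤ l2 w * (l2 a * l2 b * l2 c) := by
    rw [lintegral_lintegral_swap m2.aemeasurable]
    have : ∀ x y, w y * (a x * b y * c (x + y)) = w y * (b y * a x * c (y + x)) := by
      intro x y; rw [add_comm x y]; ring
    simp_rw [this]
    refine (lintegral_lintegral_mul_le hw hb ha (c := fun x y => c (x + y)) (M := l2 c)
      (fun x => hc.comp (measurable_const_add x)) fun x => (l2_comp_add_left c x).le).trans ?_
    exact (by ring : _ = _).le
  -- The substitution `z = x + y` makes `z` the outer variable carrying `w`; the remaining shifted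
  -- factor is then `b (z - x)`, whose `L²` norm in `x` does not depend on `z`.
  have e3 : ∫⁻ x, ∫⁻ y, w (x + y) * (a x * b y * c (x + y)) ≤ l2 w * (l2 a * l2 b * l2 c) := by
    have : ∀ x, ∫⁻ y, w (x + y) * (a x * b y * c (x + y)) =
        ∫⁻ z, w z * (a x * b (z - x) * c z) := by
      intro x
      rw [← lintegral_add_left_eq_self (fun z => w z * (a x * b (z - x) * c z)) x]
      simp
    simp_rw [this]
    have m4 : Measurable fun p : ℝ × ℝ => w p.2 * (a p.1 * b (p.2 - p.1) * c p.2) := by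
      have : Measurable fun p : ℝ × ℝ => b (p.2 - p.1) := hb.comp (by fun_prop)
      have : Measurable fun p : ℝ × ℝ => c p.2 := hc.comp measurable_snd
      fun_prop
    rw [lintegral_lintegral_swap m4.aemeasurable]
    have h2 : ∀ z, l2 (fun x => b (z - x)) = l2 b := by
      intro z
      unfold l2
      rw [lintegral_sub_left_eq_self (fun y => b y ^ (2 : ℝ)) z]
    have h3 : ∀ x y, w y * (a x * b (y - x) * c y) = w y * (c y * a x * b (y - x)) := by
      intro x y; ring
    simp_rw [h3]
    refine (lintegral_lintegral_mul_le hw hc ha (c := fun z x => b (z - x)) (M := l2 b)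
      (fun x => hb.comp (measurable_const.sub measurable_id)) fun x => (h2 x).le).trans ?_
    exact (by ring : _ = _).le
  have split : ∀ x, ∫⁻ y, (w x + w y + w (x + y)) * (a x * b y * c (x + y)) =
      (∫⁻ y, w x * (a x * b y * c (x + y))) + (∫⁻ y, w y * (a x * b y * c (x + y))) +
        ∫⁻ y, w (x + y) * (a x * b y * c (x + y)) := by
    intro x
    have n1 := m1.comp (measurable_prodMk_left (x := x))
    have n2 := m2.comp (measurable_prodMk_left (x := x))
    simp only [Function.comp_def] at n1 n2
    have n12 := n1.add n2
    simp only [Pi.add_def] at n12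
    rw [← lintegral_add_left n1, ← lintegral_add_left n12]
    congr 1 with y
    ring
  simp_rw [split]
  have q1 := m1.lintegral_prod_right' (ν := volume)
  have q12 := q1.add (m2.lintegral_prod_right' (ν := volume))
  simp only [Pi.add_def] at q12
  rw [lintegral_add_left q12, lintegral_add_left q1]
  calc _ ≤ l2 w * (l2 a * l2 b * l2 c) + l2 w * (l2 a * l2 b * l2 c) +
        l2 w * (l2 a * l2 b * l2 c) := by gcongr
    _ = _ := by ring

/-- The trilinear form of the product `H^s × H^σ → H^σ`. -/
theorem exists_lintegral_kernel_le {s σ : ℝ} (hs : 1 / 2 < s) (hσ : |σ| ≤ s) :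
    ∃ C : ℝ≥0, ∀ a b c : ℝ → ℝ≥0∞, Measurable a → Measurable b → Measurable c →
      ∫⁻ x, ∫⁻ y, ENNReal.ofReal (wt (-s) x) * a x * (ENNReal.ofReal (wt (-σ) y) * b y) *
        c (x + y) ≤
      C * (l2 a * l2 b * l2 (fun x => ENNReal.ofReal (wt (-σ) x) * c x)) := by
  set w : ℝ → ℝ≥0∞ := fun x => ENNReal.ofReal (wt (-s) x) with hw
  have mw : Measurable w := (measurable_wt _).ennreal_ofReal
  set D : ℝ := 2 * 4 ^ (s / 2)
  have hD : 0 ≤ D := by positivity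
  refine ⟨(ENNReal.ofReal D * (3 * l2 w)).toNNReal, fun a b c ha hb hc => ?_⟩
  have hfin : ENNReal.ofReal D * (3 * l2 w) ≠ ⊤ :=
    ENNReal.mul_ne_top ENNReal.ofReal_ne_top
      (ENNReal.mul_ne_top (by norm_num) (l2_wt_lt_top hs).ne)
  rw [ENNReal.coe_toNNReal hfin]
  set c' : ℝ → ℝ≥0∞ := fun x => ENNReal.ofReal (wt (-σ) x) * c x with hc'
  have mc' : Measurable c' := (measurable_wt _).ennreal_ofReal.mul hc
  -- Writing `c` as weight times `c'` supplies the factor `wt σ (x + y)` that completes the kernel.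
  have hcc : ∀ x, c x = ENNReal.ofReal (wt σ x) * c' x := by
    intro x
    rw [hc', ← mul_assoc, ← ENNReal.ofReal_mul (wt_pos _ _).le, wt_mul_wt_neg, ENNReal.ofReal_one,
      one_mul]
  calc _ ≤ ∫⁻ x, ∫⁻ y, ENNReal.ofReal D * ((w x + w y + w (x + y)) * (a x * b y * c' (x + y))) := by
        refine lintegral_mono fun x => lintegral_mono fun y => ?_
        have h1 := ENNReal.ofReal_le_ofReal (wt_kernel_le hσ x y)
        have p1 := (wt_pos (-s) x).le
        have p2 := (wt_pos (-s) y).le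
        have p3 := (wt_pos (-s) (x + y)).le
        have p4 := (wt_pos (-σ) y).le
        rw [ENNReal.ofReal_mul (by positivity), ENNReal.ofReal_mul (by positivity),
          ENNReal.ofReal_mul hD, ENNReal.ofReal_add (by positivity) (by positivity),
          ENNReal.ofReal_add (by positivity) (by positivity)] at h1
        calc _ = (ENNReal.ofReal (wt (-s) x) * ENNReal.ofReal (wt (-σ) y) *
              ENNReal.ofReal (wt σ (x + y))) * (a x * b y * c' (x + y)) := by rw [hcc (x + y)]; ring
          _ ≤ (ENNReal.ofReal D * (w x + w y + w (x + y))) * (a x * b y * c' (x + y)) := by gcongr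
          _ = _ := by ring
    _ = ENNReal.ofReal D * ∫⁻ x, ∫⁻ y, (w x + w y + w (x + y)) * (a x * b y * c' (x + y)) := by
        rw [← lintegral_const_mul' _ _ ENNReal.ofReal_ne_top]
        congr 1 with x
        rw [lintegral_const_mul' _ _ ENNReal.ofReal_ne_top]
    _ ≤ ENNReal.ofReal D * (3 * l2 w * (l2 a * l2 b * l2 c')) := by
        gcongr
        exact lintegral_trilinear_le mw ha hb mc'
    _ = _ := by ring

/-! ### Characters and the Fourier transform of integrable functions -/

/-- The character `exp (2πi x ξ)`. -/
def chr (x ξ : ℝ) : ℂ := Complex.exp (2 * Real.pi * Complex.I * x * ξ)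

theorem chr_comm (x ξ : ℝ) : chr x ξ = chr ξ x := by
  unfold chr; congr 1; ring

theorem chr_add (x y ξ : ℝ) : chr (x + y) ξ = chr x ξ * chr y ξ := by
  unfold chr; rw [← Complex.exp_add]; congr 1; push_cast; ring

theorem norm_chr (x ξ : ℝ) : ‖chr x ξ‖ = 1 := by
  unfold chr
  have : 2 * Real.pi * Complex.I * x * ξ = ((2 * Real.pi * x * ξ : ℝ) : ℂ) * Complex.I := by
    push_cast; ring
  rw [this, Complex.norm_exp_ofReal_mul_I]

theorem continuous_chr (x : ℝ) : Continuous (chr x) := by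
  unfold chr; fun_prop

theorem fourierInv_eq_chr (f : ℝ → ℂ) (x : ℝ) : 𝓕⁻ f x = ∫ ξ, chr x ξ * f ξ := by
  rw [Real.fourierInv_eq']
  congr 1 with ξ
  simp only [smul_eq_mul, chr, RCLike.inner_apply, conj_trivial]
  congr 2
  push_cast; ring

theorem fourier_eq_chr (f : ℝ → ℂ) (x : ℝ) : 𝓕 f x = ∫ ξ, chr (-x) ξ * f ξ := by
  rw [← fourierInv_eq_chr, Real.fourierInv_eq_fourier_neg, neg_neg]

theorem integrable_chr_mul {f : ℝ → ℂ} (hf : Integrable f) (x : ℝ) :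
    Integrable fun ξ => chr x ξ * f ξ :=
  hf.bdd_mul (c := 1) (continuous_chr x).aestronglyMeasurable (by simp [norm_chr])

theorem fourierInv_chr_mul (f : ℝ → ℂ) (x y : ℝ) :
    𝓕⁻ (fun ξ => chr y ξ * f ξ) x = 𝓕⁻ f (x + y) := by
  simp_rw [fourierInv_eq_chr, chr_add, mul_assoc]

theorem fourier_chr_mul (f : ℝ → ℂ) (x y : ℝ) :
    𝓕 (fun ξ => chr y ξ * f ξ) x = 𝓕 f (x - y) := by
  simp_rw [fourier_eq_chr, ← mul_assoc, ← chr_add]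
  simp [sub_eq_add_neg, add_comm]

theorem norm_fourierInv_le (f : ℝ → ℂ) (x : ℝ) : ‖𝓕⁻ f x‖ ≤ ∫ ξ, ‖f ξ‖ := by
  rw [fourierInv_eq_chr]
  refine (norm_integral_le_integral_norm _).trans_eq ?_
  simp [norm_chr]

theorem continuous_fourier {f : ℝ → ℂ} (hf : Integrable f) : Continuous (𝓕 f) :=
  VectorFourier.fourierIntegral_continuous Real.continuous_fourierChar continuous_inner hf

theorem continuous_fourierInv {f : ℝ → ℂ} (hf : Integrable f) : Continuous (𝓕⁻ f) := by
  have : 𝓕⁻ f = fun x => 𝓕 f (-x) := funext fun x => Real.fourierInv_eq_fourier_neg f x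
  rw [this]
  exact (continuous_fourier hf).comp continuous_neg

theorem integral_fourier_mul_eq {f g : ℝ → ℂ} (hf : Integrable f) (hg : Integrable g) :
    ∫ ξ, 𝓕 f ξ * g ξ = ∫ x, f x * 𝓕 g x := by
  simpa using! VectorFourier.integral_bilin_fourierIntegral_eq_flip (.mul ℂ ℂ) (L := innerₗ ℝ)
    Real.continuous_fourierChar continuous_inner hf hg

theorem integral_fourierInv_mul_eq {f g : ℝ → ℂ} (hf : Integrable f) (hg : Integrable g) :
    ∫ ξ, 𝓕⁻ f ξ * g ξ = ∫ x, f x * 𝓕⁻ g x := by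
  have h := integral_fourier_mul_eq hf hg.comp_neg
  rw [← integral_neg_eq_self] at h
  simp only [neg_neg] at h
  simp_rw [Real.fourierInv_eq_fourier_neg f]
  rw [h, Real.fourierInv_eq_fourier_comp_neg]

/-- Plancherel's theorem for functions in `L¹ ∩ L²`. -/
theorem eLpNorm_fourier {f : ℝ → ℂ} (h1 : Integrable f) (h2 : MemLp f 2) :
    eLpNorm (𝓕 f) 2 = eLpNorm f 2 := by
  set F : Lp ℂ 2 (volume : Measure ℝ) := h2.toLp f with hF
  -- The integral transform and the `L²` extension agree because both give the same pairing with
  -- smooth compactly supported functions, by the multiplication formula.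
  have key : 𝓕 f =ᵐ[volume] (𝓕 F : Lp ℂ 2 (volume : Measure ℝ)) := by
    apply ae_eq_of_integral_contDiff_smul_eq
    · exact (continuous_fourier h1).locallyIntegrable
    · exact (Lp.memLp _).locallyIntegrable (by norm_num)
    · intro g g_smooth g_cpt
      have hg₁ : HasCompactSupport (Complex.ofRealCLM ∘ g) := g_cpt.comp_left rfl
      have hg₂ : ContDiff ℝ ∞ (Complex.ofRealCLM ∘ g) := by fun_prop
      set φ : 𝓢(ℝ, ℂ) := hg₁.toSchwartzMap hg₂ with hφ
      have hφg : ∀ x, φ x = (g x : ℂ) := fun x => rfl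
      have e := DFunLike.congr_fun (Lp.fourier_toTemperedDistribution_eq F) φ
      rw [TemperedDistribution.fourier_apply, Lp.toTemperedDistribution_apply,
        Lp.toTemperedDistribution_apply] at e
      have e1 : ∫ x, (𝓕 φ : 𝓢(ℝ, ℂ)) x • F x = ∫ x, 𝓕 (φ : ℝ → ℂ) x * f x := by
        apply integral_congr_ae
        filter_upwards [h2.coeFn_toLp] with x hx
        rw [hF, hx, SchwartzMap.fourier_coe, smul_eq_mul]
      rw [e1, integral_fourier_mul_eq φ.integrable h1] at e
      simpa [hφg] using e
  rw [eLpNorm_congr_ae key, ← Lp.enorm_def, ← eLpNorm_congr_ae h2.coeFn_toLp, ← Lp.enorm_def,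
    ← ofReal_norm, ← ofReal_norm, Lp.norm_fourier_eq]

theorem eLpNorm_fourierInv {f : ℝ → ℂ} (h1 : Integrable f) (h2 : MemLp f 2) :
    eLpNorm (𝓕⁻ f) 2 = eLpNorm f 2 := by
  have : 𝓕⁻ f = 𝓕 f ∘ Neg.neg := funext fun x => Real.fourierInv_eq_fourier_neg f x
  rw [this, eLpNorm_comp_measurePreserving (continuous_fourier h1).aestronglyMeasurable
    (Measure.measurePreserving_neg volume), eLpNorm_fourier h1 h2]

theorem integrable_bdd_mul_schwartz {f : ℝ → ℂ} (hf : AEStronglyMeasurable f) {B : ℝ}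
    (hB : ∀ x, ‖f x‖ ≤ B) (φ : 𝓢(ℝ, ℂ)) : Integrable fun x => f x * φ x :=
  φ.integrable.bdd_mul (c := B) hf (ae_of_all _ hB)

/-- The multiplication formula is applied to each factor in turn; multiplying by a character
translates the transform, which produces `Φ (ξ + η)`. -/
theorem integral_fourierInv_mul_fourierInv_mul_fourier {M G : ℝ → ℂ} (hM : Integrable M)
    (hG : Integrable G) (Φ : 𝓢(ℝ, ℂ)) :
    ∫ x, 𝓕⁻ M x * (𝓕⁻ G x * (𝓕 Φ : 𝓢(ℝ, ℂ)) x) = ∫ ξ, ∫ η, M ξ * (G η * Φ (ξ + η)) := by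
  have hp : Integrable fun x => 𝓕⁻ G x * (𝓕 Φ : 𝓢(ℝ, ℂ)) x :=
    integrable_bdd_mul_schwartz (continuous_fourierInv hG).aestronglyMeasurable
      (norm_fourierInv_le G) _
  rw [integral_fourierInv_mul_eq hM hp]
  congr 1 with ξ
  rw [integral_const_mul]
  congr 1
  rw [fourierInv_eq_chr]
  have e : ∀ x, chr ξ x * (𝓕⁻ G x * (𝓕 Φ : 𝓢(ℝ, ℂ)) x) =
      𝓕⁻ G x * (chr ξ x * (𝓕 Φ : 𝓢(ℝ, ℂ)) x) := fun x => by ring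
  simp_rw [e]
  rw [integral_fourierInv_mul_eq hG (integrable_chr_mul (𝓕 Φ : 𝓢(ℝ, ℂ)).integrable ξ)]
  congr 1 with η
  rw [fourierInv_chr_mul, ← SchwartzMap.fourierInv_coe, FourierTransform.fourierInv_fourier_eq,
    add_comm]

/-! ### Multiplication by the low frequencies of a bounded function -/

/-- The convolution of a bounded function with the kernel of the Fourier multiplier `χ`. -/
def lowPass (χ : 𝓢(ℝ, ℂ)) (f : ℝ → ℂ) (x : ℝ) : ℂ := ∫ y, f y * (𝓕 χ : 𝓢(ℝ, ℂ)) (y - x)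

theorem norm_lowPass_le (χ : 𝓢(ℝ, ℂ)) {f : ℝ → ℂ} {B : ℝ} (hB : ∀ᵐ x, ‖f x‖ ≤ B) (x : ℝ) :
    ‖lowPass χ f x‖ ≤ B * ∫ y, ‖(𝓕 χ : 𝓢(ℝ, ℂ)) y‖ := by
  have hi : Integrable fun y => (𝓕 χ : 𝓢(ℝ, ℂ)) (y - x) :=
    (𝓕 χ : 𝓢(ℝ, ℂ)).integrable.comp_sub_right x
  refine (norm_integral_le_of_norm_le (hi.norm.const_mul B) ?_).trans_eq ?_
  · filter_upwards [hB] with y hy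
    rw [norm_mul]
    gcongr
  · rw [integral_const_mul, integral_sub_right_eq_self (fun y => ‖(𝓕 χ : 𝓢(ℝ, ℂ)) y‖) x]

/-- Fubini: the shear `(x, y) ↦ (x, y - x)` preserves measure, so the kernel times `u` is integrable
on the plane, and the bounded factor keeps it so. -/
theorem lowPass_integral_eq (χ : 𝓢(ℝ, ℂ)) {f : ℝ → ℂ} {B : ℝ} (hf : AEStronglyMeasurable f)
    (hB : ∀ᵐ x, ‖f x‖ ≤ B) {u : ℝ → ℂ} (hu : Integrable u) :
    ∫ x, lowPass χ f x * u x = ∫ y, f y * ∫ x, (𝓕 χ : 𝓢(ℝ, ℂ)) (y - x) * u x := by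
  set K : 𝓢(ℝ, ℂ) := 𝓕 χ
  have h0 : Integrable (fun p : ℝ × ℝ => K p.2 * u p.1) (volume.prod volume) := by
    simpa [mul_comm] using hu.mul_prod K.integrable
  have h1 : Integrable (fun p : ℝ × ℝ => K (p.2 - p.1) * u p.1) (volume.prod volume) :=
    ((measurePreserving_prod_sub (volume : Measure ℝ) volume).integrable_comp
      h0.aestronglyMeasurable).2 h0
  have h2 : Integrable (fun p : ℝ × ℝ => f p.2 * (K (p.2 - p.1) * u p.1))
      (volume.prod volume) :=
    h1.bdd_mul (c := B) hf.comp_snd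
      (Measure.quasiMeasurePreserving_snd.ae hB)
  simp_rw [lowPass, ← integral_mul_const, ← integral_const_mul, mul_assoc]
  exact integral_integral_swap h2

/-- Frequency localisation: if no frequency of `𝓕⁻ G` can be matched with one of `𝓕 H` by a
frequency in the support of `χ`, then the trilinear pairing vanishes. -/
theorem integral_lowPass_mul_eq_zero (χ : 𝓢(ℝ, ℂ)) {f : ℝ → ℂ} {B : ℝ}
    (hf : AEStronglyMeasurable f) (hB : ∀ᵐ x, ‖f x‖ ≤ B) {G H : ℝ → ℂ} (hG : Integrable G)
    (hH : Integrable H) (hGH : Integrable fun x => 𝓕⁻ G x * 𝓕 H x)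
    (hvan : ∀ ξ η, χ (ξ - η) * (G η * H ξ) = 0) :
    ∫ x, lowPass χ f x * (𝓕⁻ G x * 𝓕 H x) = 0 := by
  rw [lowPass_integral_eq χ hf hB hGH]
  set K : 𝓢(ℝ, ℂ) := 𝓕 χ with hK
  have key : ∀ y, ∫ x, K (y - x) * (𝓕⁻ G x * 𝓕 H x) = 0 := by
    intro y
    have hKy : Integrable fun x => K (y - x) := K.integrable.comp_sub_left y
    have hv : Integrable fun x => 𝓕⁻ G x * K (y - x) :=
      hKy.bdd_mul (c := ∫ ξ, ‖G ξ‖) (continuous_fourierInv hG).aestronglyMeasurable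
        (ae_of_all _ (norm_fourierInv_le G))
    have e1 : ∀ x, K (y - x) * (𝓕⁻ G x * 𝓕 H x) = 𝓕 H x * (𝓕⁻ G x * K (y - x)) :=
      fun x => by ring
    simp_rw [e1]
    rw [integral_fourier_mul_eq hH hv]
    have e2 : ∀ ξ, H ξ * 𝓕 (fun x => 𝓕⁻ G x * K (y - x)) ξ = 0 := by
      intro ξ
      rw [fourier_eq_chr]
      have e3 : ∀ x, chr (-ξ) x * (𝓕⁻ G x * K (y - x)) = 𝓕⁻ G x * (chr (-ξ) x * K (y - x)) :=
        fun x => by ring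
      simp_rw [e3]
      rw [integral_fourierInv_mul_eq hG (integrable_chr_mul hKy _), ← integral_const_mul]
      apply integral_eq_zero_of_ae
      refine ae_of_all _ fun η => ?_
      -- Reflecting, translating and modulating the kernel turns its inverse transform into `χ (ξ -
      -- η)` up to a phase, which is where the support hypothesis can act.
      have e4 : 𝓕⁻ (fun x => chr (-ξ) x * K (y - x)) η = chr (η - ξ) y * χ (ξ - η) := by
        rw [fourierInv_chr_mul, fourierInv_eq_chr,
          ← integral_sub_left_eq_self (fun x => chr (η + -ξ) x * K (y - x)) volume y]
        have e5 : ∀ t, chr (η + -ξ) (y - t) * K (y - (y - t)) =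
            chr (η - ξ) y * (chr (ξ - η) t * K t) := by
          intro t
          rw [chr_comm _ (y - t), sub_eq_add_neg y t, chr_add, chr_comm y, ← sub_eq_add_neg,
            ← mul_assoc (chr (η - ξ) y)]
          congr 2
          · unfold chr; congr 1; push_cast; ring
          · ring
        simp_rw [e5]
        rw [integral_const_mul, ← fourierInv_eq_chr, hK, ← SchwartzMap.fourierInv_coe,
          FourierTransform.fourierInv_fourier_eq]
      change H ξ * (G η * 𝓕⁻ (fun x => chr (-ξ) x * K (y - x)) η) = 0
      rw [e4]
      linear_combination chr (η - ξ) y * hvan ξ η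
    simp [e2]
  simp [key]

theorem eLpNorm_two_eq_l2 (f : ℝ → ℂ) : eLpNorm f 2 = l2 fun x => ‖f x‖ₑ := by
  rw [eLpNorm_eq_lintegral_rpow_enorm_toReal (by norm_num) (by norm_num)]
  simp [l2]

theorem memLp_fourier {f : ℝ → ℂ} (h1 : Integrable f) (h2 : MemLp f 2) : MemLp (𝓕 f) 2 :=
  ⟨(continuous_fourier h1).aestronglyMeasurable, by
    rw [eLpNorm_fourier h1 h2]; exact h2.eLpNorm_lt_top⟩

theorem memLp_fourierInv {f : ℝ → ℂ} (h1 : Integrable f) (h2 : MemLp f 2) : MemLp (𝓕⁻ f) 2 :=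
  ⟨(continuous_fourierInv h1).aestronglyMeasurable, by
    rw [eLpNorm_fourierInv h1 h2]; exact h2.eLpNorm_lt_top⟩

/-- Bounded functions act on pairs of `L²` functions. -/
theorem enorm_integral_mul_fourier_le {F G H : ℝ → ℂ} {A : ℝ} (hA : ∀ x, ‖F x‖ ≤ A)
    (hG : Integrable G) (hG2 : MemLp G 2) (hH : Integrable H) (hH2 : MemLp H 2) :
    ‖∫ x, F x * (𝓕⁻ G x * 𝓕 H x)‖ₑ ≤
      ENNReal.ofReal A * (l2 (fun x => ‖G x‖ₑ) * l2 (fun x => ‖H x‖ₑ)) := by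
  calc ‖∫ x, F x * (𝓕⁻ G x * 𝓕 H x)‖ₑ ≤ ∫⁻ x, ‖F x * (𝓕⁻ G x * 𝓕 H x)‖ₑ :=
        enorm_integral_le_lintegral_enorm _
    _ ≤ ∫⁻ x, ENNReal.ofReal A * (‖𝓕⁻ G x‖ₑ * ‖𝓕 H x‖ₑ) := by
        refine lintegral_mono fun x => ?_
        rw [enorm_mul, enorm_mul, ← ofReal_norm (F x)]
        gcongr
        exact hA x
    _ = ENNReal.ofReal A * ∫⁻ x, ‖𝓕⁻ G x‖ₑ * ‖𝓕 H x‖ₑ :=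
        lintegral_const_mul' _ _ ENNReal.ofReal_ne_top
    _ ≤ ENNReal.ofReal A * (l2 (fun x => ‖𝓕⁻ G x‖ₑ) * l2 (fun x => ‖𝓕 H x‖ₑ)) := by
        gcongr
        exact lintegral_mul_le_l2 (continuous_fourierInv hG).enorm.measurable
          (continuous_fourier hH).enorm.measurable
    _ = _ := by
        rw [← eLpNorm_two_eq_l2, ← eLpNorm_two_eq_l2, eLpNorm_fourierInv hG hG2,
          eLpNorm_fourier hH hH2, eLpNorm_two_eq_l2, eLpNorm_two_eq_l2]

/-! ### Unit frequency bands and almost orthogonality -/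

theorem l2_sq (f : ℝ → ℝ≥0∞) : l2 f ^ (2 : ℝ) = ∫⁻ x, f x ^ (2 : ℝ) := by
  rw [l2, ← ENNReal.rpow_mul]; norm_num

/-- Bessel-type inequality for restrictions to sets of bounded overlap. -/
theorem sum_l2_indicator_sq_le {S : Finset ℤ} {A : ℤ → Set ℝ} (hA : ∀ k, MeasurableSet (A k))
    {m : ℕ} (hm : ∀ x, (∑ k ∈ S, (A k).indicator (fun _ => (1 : ℝ≥0∞)) x) ≤ m)
    {a : ℝ → ℝ≥0∞} (ha : Measurable a) :
    ∑ k ∈ S, l2 ((A k).indicator a) ^ (2 : ℝ) ≤ m * l2 a ^ (2 : ℝ) := by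
  simp_rw [l2_sq]
  have hmeas : ∀ k ∈ S, Measurable fun x => (A k).indicator a x ^ (2 : ℝ) :=
    fun k _ => (ha.indicator (hA k)).pow_const _
  rw [← lintegral_finsetSum _ hmeas, ← lintegral_const_mul _ (ha.pow_const _)]
  refine lintegral_mono fun x => ?_
  calc ∑ k ∈ S, (A k).indicator a x ^ (2 : ℝ)
      = ∑ k ∈ S, (A k).indicator (fun _ => (1 : ℝ≥0∞)) x * a x ^ (2 : ℝ) := by
        refine Finset.sum_congr rfl fun k _ => ?_
        by_cases h : x ∈ A k <;> simp [h]
    _ = (∑ k ∈ S, (A k).indicator (fun _ => (1 : ℝ≥0∞)) x) * a x ^ (2 : ℝ) := by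
        rw [Finset.sum_mul]
    _ ≤ m * a x ^ (2 : ℝ) := by gcongr; exact hm x

/-- The intervals are closed of length three, so an integer point lies in four of them. -/
theorem sum_indicator_Icc_le (S : Finset ℤ) (x : ℝ) :
    (∑ k ∈ S, (Set.Icc ((k : ℝ) - 1) (k + 2)).indicator (fun _ => (1 : ℝ≥0∞)) x) ≤ (4 : ℕ) := by
  have h1 : ∑ k ∈ S, (Set.Icc ((k : ℝ) - 1) (k + 2)).indicator (fun _ => (1 : ℝ≥0∞)) x =
      ((S.filter fun k : ℤ => x ∈ Set.Icc ((k : ℝ) - 1) (k + 2)).card : ℝ≥0∞) := by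
    classical
    simp only [Set.indicator_apply, Finset.sum_boole]
  rw [h1]
  have h2 : (S.filter fun k : ℤ => x ∈ Set.Icc ((k : ℝ) - 1) (k + 2)) ⊆
      Finset.Icc (⌊x⌋ - 2) (⌊x⌋ + 1) := by
    intro k hk
    obtain ⟨hk1, hk2⟩ := (Finset.mem_filter.1 hk).2
    have f1 := Int.floor_le x
    have f2 := Int.lt_floor_add_one x
    rw [Finset.mem_Icc]
    constructor
    · have : (⌊x⌋ : ℝ) ≤ ((k + 2 : ℤ) : ℝ) := by push_cast; linarith
      have := Int.cast_le.1 this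
      omega
    · have : (k : ℝ) < ((⌊x⌋ + 2 : ℤ) : ℝ) := by push_cast; linarith
      have := Int.cast_lt.1 this
      omega
  have h3 := Finset.card_le_card h2
  have h4 : (Finset.Icc (⌊x⌋ - 2) (⌊x⌋ + 1)).card = 4 := by
    rw [Int.card_Icc]; omega
  rw [h4] at h3
  exact_mod_cast h3

theorem sum_l2_indicator_mul_le (S : Finset ℤ) {a b : ℝ → ℝ≥0∞} (ha : Measurable a)
    (hb : Measurable b) :
    ∑ k ∈ S, l2 ((Set.Icc ((k : ℝ) - 1) (k + 2)).indicator a) *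
      l2 ((Set.Icc ((k : ℝ) - 1) (k + 2)).indicator b) ≤ 4 * (l2 a * l2 b) := by
  have key : ∀ {c : ℝ → ℝ≥0∞}, Measurable c →
      (∑ k ∈ S, l2 ((Set.Icc ((k : ℝ) - 1) (k + 2)).indicator c) ^ (2 : ℝ)) ^ (1 / 2 : ℝ) ≤
        (4 : ℝ≥0∞) ^ (1 / 2 : ℝ) * l2 c := by
    intro c hc
    have := sum_l2_indicator_sq_le (S := S) (A := fun k : ℤ => Set.Icc ((k : ℝ) - 1) (k + 2))
      (fun _ => measurableSet_Icc) (sum_indicator_Icc_le S) hc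
    refine (ENNReal.rpow_le_rpow this (by norm_num : (0 : ℝ) ≤ 1 / 2)).trans_eq ?_
    rw [ENNReal.mul_rpow_of_nonneg _ _ (by norm_num), ← ENNReal.rpow_mul]
    norm_num
  refine (ENNReal.inner_le_Lp_mul_Lq S _ _ Real.HolderConjugate.two_two).trans ?_
  refine (mul_le_mul' (key ha) (key hb)).trans_eq ?_
  have : (4 : ℝ≥0∞) ^ (1 / 2 : ℝ) * (4 : ℝ≥0∞) ^ (1 / 2 : ℝ) = 4 := by
    rw [← ENNReal.rpow_add _ _ (by norm_num) (by norm_num)]; norm_num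
  calc _ = ((4 : ℝ≥0∞) ^ (1 / 2 : ℝ) * (4 : ℝ≥0∞) ^ (1 / 2 : ℝ)) * (l2 a * l2 b) := by ring
    _ = _ := by rw [this]

/-- On one unit frequency band the weights cancel. -/
theorem exists_l2_band_le (σ : ℝ) : ∃ C : ℝ≥0, ∀ (k : ℤ) (a b : ℝ → ℝ≥0∞),
    l2 ((Set.Ico (k : ℝ) (k + 1)).indicator a) *
      l2 ((Set.Icc ((k : ℝ) - 1) (k + 2)).indicator b) ≤
    C * (l2 ((Set.Icc ((k : ℝ) - 1) (k + 2)).indicator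
        fun x => ENNReal.ofReal (wt σ x) * a x) *
      l2 ((Set.Icc ((k : ℝ) - 1) (k + 2)).indicator fun x => ENNReal.ofReal (wt (-σ) x) * b x)) := by
  obtain ⟨C₁, hC₁, h₁⟩ := exists_wt_le (-σ)
  obtain ⟨C₂, hC₂, h₂⟩ := exists_wt_le σ
  -- The weight is frozen at the integer `k`, which is within distance 2 of every point of the
  -- enlarged band. For `τ = σ` and `τ = -σ` the frozen values are mutually inverse, so the constant
  -- is independent of `k`.
  have key : ∀ (τ D : ℝ), 0 < D → (∀ x y : ℝ, |x - y| ≤ 2 → wt (-τ) x ≤ D * wt (-τ) y) →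
      ∀ (k : ℤ) (c : ℝ → ℝ≥0∞), l2 ((Set.Icc ((k : ℝ) - 1) (k + 2)).indicator c) ≤
        ENNReal.ofReal (D * wt (-τ) k) *
          l2 ((Set.Icc ((k : ℝ) - 1) (k + 2)).indicator fun x => ENNReal.ofReal (wt τ x) * c x) := by
    intro τ D hD hwt k c
    rw [← l2_const_mul ENNReal.ofReal_ne_top]
    refine l2_mono fun x => ?_
    by_cases hx : x ∈ Set.Icc ((k : ℝ) - 1) (k + 2)
    · simp only [Set.indicator_of_mem hx]
      rw [← mul_assoc, ← ENNReal.ofReal_mul (mul_nonneg hD.le (wt_pos _ _).le)]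
      have h : wt (-τ) x ≤ D * wt (-τ) k :=
        hwt x k (abs_le.2 ⟨by linarith [hx.1], by linarith [hx.2]⟩)
      have : 1 ≤ D * wt (-τ) k * wt τ x := by
        rw [← wt_neg_mul_wt τ x]
        exact mul_le_mul_of_nonneg_right h (wt_pos _ _).le
      calc c x = ENNReal.ofReal 1 * c x := by simp
        _ ≤ _ := by gcongr
    · simp [hx]
  refine ⟨(C₁ * C₂).toNNReal, fun k a b => ?_⟩
  have e : ((C₁ * C₂).toNNReal : ℝ≥0∞) =
      ENNReal.ofReal (C₁ * wt (-σ) k) * ENNReal.ofReal (C₂ * wt σ k) := by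
    have p1 := wt_pos σ k
    have p2 := wt_pos (-σ) k
    rw [← ENNReal.ofReal_mul (by positivity)]
    change ENNReal.ofReal _ = _
    congr 1
    linear_combination -(C₁ * C₂) * wt_neg_mul_wt σ k
  have hsub : Set.Ico (k : ℝ) (k + 1) ⊆ Set.Icc ((k : ℝ) - 1) (k + 2) := fun x hx =>
    ⟨by linarith [hx.1], by linarith [hx.2]⟩
  have i1 : l2 ((Set.Ico (k : ℝ) (k + 1)).indicator a) ≤
      l2 ((Set.Icc ((k : ℝ) - 1) (k + 2)).indicator a) :=
    l2_mono fun x => Set.indicator_le_indicator_of_subset hsub (fun _ => zero_le) x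
  have i2 := key σ C₁ hC₁ h₁ k a
  have i3 := key (-σ) C₂ hC₂ (by rwa [neg_neg]) k b
  rw [neg_neg] at i3
  refine (mul_le_mul' (i1.trans i2) i3).trans_eq ?_
  rw [e]; ring

theorem aestronglyMeasurable_lowPass (χ : 𝓢(ℝ, ℂ)) {f : ℝ → ℂ} (hf : AEStronglyMeasurable f) :
    AEStronglyMeasurable (lowPass χ f) := by
  have h : AEStronglyMeasurable (fun p : ℝ × ℝ => f p.2 * (𝓕 χ : 𝓢(ℝ, ℂ)) (p.2 - p.1))
      (volume.prod volume) :=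
    hf.comp_snd.mul
      ((𝓕 χ : 𝓢(ℝ, ℂ)).continuous.comp (by fun_prop)).aestronglyMeasurable
  exact h.integral_prod_right'

/-- A band of `G` interacts only with frequencies of `Φ` at distance less than one, so `Φ` may be
cut to the enlarged band; then the sup bound and Plancherel suffice. -/
theorem enorm_integral_lowPass_band_le {χ : 𝓢(ℝ, ℂ)} (hχ : ∀ x, 1 ≤ |x| → χ x = 0) {f : ℝ → ℂ}
    {B A : ℝ} (hf : AEStronglyMeasurable f) (hB : ∀ᵐ x, ‖f x‖ ≤ B)
    (hA : ∀ x, ‖lowPass χ f x‖ ≤ A) {G : ℝ → ℂ}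
    (hG : Integrable G) (hG2 : MemLp G 2) (Φ : 𝓢(ℝ, ℂ)) (k : ℤ) :
    ‖∫ x, lowPass χ f x *
        (𝓕⁻ ((Set.Ico (k : ℝ) (k + 1)).indicator G) x * 𝓕 (Φ : ℝ → ℂ) x)‖ₑ ≤
      ENNReal.ofReal A * (l2 ((Set.Ico (k : ℝ) (k + 1)).indicator fun x => ‖G x‖ₑ) *
        l2 ((Set.Icc ((k : ℝ) - 1) (k + 2)).indicator fun x => ‖Φ x‖ₑ)) := by
  set I := Set.Ico (k : ℝ) (k + 1)
  set J := Set.Icc ((k : ℝ) - 1) (k + 2)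
  have mI : MeasurableSet I := measurableSet_Ico
  have mJ : MeasurableSet J := measurableSet_Icc
  have g1 := hG.indicator mI
  have g2 := hG2.indicator mI
  have p1 := Φ.integrable (μ := volume) |>.indicator mJ
  have p2 := (Φ.memLp 2 volume).indicator mJ
  have q1 := Φ.integrable (μ := volume) |>.indicator mJ.compl
  have q2 := (Φ.memLp 2 volume).indicator mJ.compl
  have split : ∀ x, 𝓕 (Φ : ℝ → ℂ) x = 𝓕 (J.indicator Φ) x + 𝓕 (Jᶜ.indicator Φ) x := by
    intro x
    rw [fourier_eq_chr, fourier_eq_chr, fourier_eq_chr,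
      ← integral_add (integrable_chr_mul p1 _) (integrable_chr_mul q1 _)]
    congr 1 with ξ
    rw [← mul_add, ← Pi.add_apply (J.indicator Φ), Set.indicator_self_add_compl]
  have i1 := (memLp_fourierInv g1 g2).integrable_mul (memLp_fourier p1 p2)
  have i2 := (memLp_fourierInv g1 g2).integrable_mul (memLp_fourier q1 q2)
  have j1 := i1.bdd_mul (c := A) (aestronglyMeasurable_lowPass χ hf) (ae_of_all _ hA)
  have j2 := i2.bdd_mul (c := A) (aestronglyMeasurable_lowPass χ hf) (ae_of_all _ hA)
  have hz : ∫ x, lowPass χ f x * (𝓕⁻ (I.indicator G) x * 𝓕 (Jᶜ.indicator Φ) x) = 0 := by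
    refine integral_lowPass_mul_eq_zero χ hf hB g1 q1 i2 fun ξ η => ?_
    by_cases hη : η ∈ I
    · by_cases hξ : ξ ∈ J
      · simp [hξ]
      · have : 1 ≤ |ξ - η| := by
          by_contra! h
          rw [abs_lt] at h
          exact hξ ⟨by linarith [hη.1], by linarith [hη.2]⟩
        simp [hχ _ this]
    · simp [hη]
  have e : ∫ x, lowPass χ f x * (𝓕⁻ (I.indicator G) x * 𝓕 (Φ : ℝ → ℂ) x) =
      ∫ x, lowPass χ f x * (𝓕⁻ (I.indicator G) x * 𝓕 (J.indicator Φ) x) := by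
    simp only [Pi.mul_apply] at j1 j2
    rw [← add_zero (∫ x, lowPass χ f x * (𝓕⁻ (I.indicator G) x * 𝓕 (J.indicator Φ) x)), ← hz,
      ← integral_add j1 j2]
    congr 1 with x
    rw [split x]
    ring
  rw [e]
  refine (enorm_integral_mul_fourier_le hA g1 g2 p1 p2).trans_eq ?_
  simp only [enorm_indicator_eq_indicator_enorm]

/-- The product with the low-frequency part of a bounded function is bounded on `H^σ`. -/
theorem exists_lowPass_bound (σ : ℝ) {χ : 𝓢(ℝ, ℂ)} (hχ : ∀ x, 1 ≤ |x| → χ x = 0) :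
    ∃ C : ℝ≥0, ∀ (f : ℝ → ℂ) (B : ℝ), AEStronglyMeasurable f → (∀ᵐ x, ‖f x‖ ≤ B) →
      ∀ G : ℝ → ℂ, Measurable G → Integrable G →
      MemLp G 2 → ∀ N : ℕ, (∀ η, (N : ℝ) ≤ |η| → G η = 0) → ∀ Φ : 𝓢(ℝ, ℂ),
      ‖∫ x, lowPass χ f x * (𝓕⁻ G x * 𝓕 (Φ : ℝ → ℂ) x)‖ₑ ≤
        C * ENNReal.ofReal B * (l2 (fun x => ENNReal.ofReal (wt σ x) * ‖G x‖ₑ) *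
          l2 (fun x => ENNReal.ofReal (wt (-σ) x) * ‖Φ x‖ₑ)) := by
  obtain ⟨C, hC⟩ := exists_l2_band_le σ
  set κ : ℝ := ∫ y, ‖(𝓕 χ : 𝓢(ℝ, ℂ)) y‖ with hκ
  have hκ0 : 0 ≤ κ := integral_nonneg fun _ => norm_nonneg _
  -- `κ` is the `L¹` norm of the kernel, `C` the cost of freezing the weight on a band, and 4 the
  -- overlap of the enlarged bands.
  refine ⟨κ.toNNReal * C * 4, fun f B hf hB G mG hG hG2 N hN Φ => ?_⟩
  have hA := norm_lowPass_le χ hB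
  have hB0 : 0 ≤ B := by
    obtain ⟨x, hx⟩ := hB.exists
    exact (norm_nonneg _).trans hx
  set S : Finset ℤ := Finset.Ico (-(N : ℤ)) N
  have hsum : ∀ η, G η = ∑ k ∈ S, (Set.Ico (k : ℝ) (k + 1)).indicator G η := by
    intro η
    by_cases hη : (N : ℝ) ≤ |η|
    · have h0 := hN η hη
      refine h0.trans (Finset.sum_eq_zero fun k _ => ?_).symm
      by_cases h : η ∈ Set.Ico (k : ℝ) (k + 1) <;> simp [h, h0]
    · push Not at hη
      rw [abs_lt] at hη
      have f1 := Int.floor_le η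
      have f2 := Int.lt_floor_add_one η
      rw [Finset.sum_eq_single ⌊η⌋]
      · rw [Set.indicator_of_mem (show η ∈ Set.Ico (⌊η⌋ : ℝ) (⌊η⌋ + 1) from ⟨f1, f2⟩)]
      · intro k _ hk
        apply Set.indicator_of_notMem
        intro h
        exact hk (Int.floor_eq_iff.2 h).symm
      · intro h
        exfalso
        apply h
        rw [Finset.mem_Ico]
        constructor
        · have : ((-(N : ℤ) : ℤ) : ℝ) < ((⌊η⌋ + 1 : ℤ) : ℝ) := by push_cast; linarith
          have := Int.cast_lt.1 this
          omega
        · have : (⌊η⌋ : ℝ) < ((N : ℤ) : ℝ) := by push_cast; linarith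
          exact Int.cast_lt.1 this
  have g1 : ∀ k : ℤ, Integrable ((Set.Ico (k : ℝ) (k + 1)).indicator G) := fun k =>
    hG.indicator measurableSet_Ico
  have hF : ∀ x, 𝓕⁻ G x = ∑ k ∈ S, 𝓕⁻ ((Set.Ico (k : ℝ) (k + 1)).indicator G) x := by
    intro x
    simp_rw [fourierInv_eq_chr]
    rw [← integral_finsetSum _ fun k _ => integrable_chr_mul (g1 k) x]
    congr 1 with ξ
    rw [← Finset.mul_sum, ← hsum]
  have hi : ∀ k ∈ S, Integrable fun x => lowPass χ f x *
      (𝓕⁻ ((Set.Ico (k : ℝ) (k + 1)).indicator G) x * 𝓕 (Φ : ℝ → ℂ) x) := by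
    intro k _
    refine Integrable.bdd_mul (c := B * κ) ?_ (aestronglyMeasurable_lowPass χ hf) (ae_of_all _ hA)
    exact integrable_bdd_mul_schwartz (continuous_fourierInv (g1 k)).aestronglyMeasurable
      (norm_fourierInv_le _) (𝓕 Φ : 𝓢(ℝ, ℂ))
  have e : ∫ x, lowPass χ f x * (𝓕⁻ G x * 𝓕 (Φ : ℝ → ℂ) x) = ∑ k ∈ S, ∫ x, lowPass χ f x *
      (𝓕⁻ ((Set.Ico (k : ℝ) (k + 1)).indicator G) x * 𝓕 (Φ : ℝ → ℂ) x) := by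
    rw [← integral_finsetSum _ hi]
    congr 1 with x
    rw [hF, Finset.sum_mul, Finset.mul_sum]
  rw [e]
  have mΦ : Measurable fun x => ENNReal.ofReal (wt (-σ) x) * ‖Φ x‖ₑ :=
    (measurable_wt _).ennreal_ofReal.mul Φ.continuous.enorm.measurable
  have mG' : Measurable fun x => ENNReal.ofReal (wt σ x) * ‖G x‖ₑ :=
    (measurable_wt _).ennreal_ofReal.mul mG.enorm
  calc _ ≤ ∑ k ∈ S, ‖∫ x, lowPass χ f x *
        (𝓕⁻ ((Set.Ico (k : ℝ) (k + 1)).indicator G) x * 𝓕 (Φ : ℝ → ℂ) x)‖ₑ :=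
        enorm_sum_le _ _
    _ ≤ ∑ k ∈ S, ENNReal.ofReal (B * κ) * (C *
        (l2 ((Set.Icc ((k : ℝ) - 1) (k + 2)).indicator
          fun x => ENNReal.ofReal (wt σ x) * ‖G x‖ₑ) *
        l2 ((Set.Icc ((k : ℝ) - 1) (k + 2)).indicator
          fun x => ENNReal.ofReal (wt (-σ) x) * ‖Φ x‖ₑ))) := by
        refine Finset.sum_le_sum fun k _ => ?_
        refine (enorm_integral_lowPass_band_le hχ hf hB hA hG hG2 Φ k).trans ?_
        exact mul_le_mul' le_rfl (hC k _ _)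
    _ = ENNReal.ofReal (B * κ) * (C * ∑ k ∈ S,
        l2 ((Set.Icc ((k : ℝ) - 1) (k + 2)).indicator
          fun x => ENNReal.ofReal (wt σ x) * ‖G x‖ₑ) *
        l2 ((Set.Icc ((k : ℝ) - 1) (k + 2)).indicator
          fun x => ENNReal.ofReal (wt (-σ) x) * ‖Φ x‖ₑ)) := by
        rw [Finset.mul_sum, Finset.mul_sum]
    _ ≤ ENNReal.ofReal (B * κ) * (C * (4 * (l2 (fun x => ENNReal.ofReal (wt σ x) * ‖G x‖ₑ) *
          l2 (fun x => ENNReal.ofReal (wt (-σ) x) * ‖Φ x‖ₑ)))) := by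
        gcongr
        exact sum_l2_indicator_mul_le S mG' mΦ
    _ = _ := by
        rw [ENNReal.ofReal_mul hB0]
        push_cast
        change ENNReal.ofReal B * ENNReal.ofReal κ * _ = ENNReal.ofReal κ * _ * _ * _ * _
        ring

/-! ### Low-frequency parts as inverse Fourier transforms -/

/-- The kernel function of `lowFreq` as a Schwartz function. -/
def IsCutoff.kernel {χ : ℝ → ℝ} (hχ : IsCutoff χ) (j : ℕ) (x : ℝ) : 𝓢(ℝ, ℂ) :=
  (hχ.hasCompactSupport_kernelFun j x).toSchwartzMap (hχ.contDiff_kernelFun j x)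

theorem IsCutoff.kernel_apply {χ : ℝ → ℝ} (hχ : IsCutoff χ) (j : ℕ) (x ξ : ℝ) :
    hχ.kernel j x ξ = (χ ((2 ^ j : ℝ)⁻¹ * ξ) : ℂ) * chr x ξ := rfl

theorem lowFreq_eq {χ : ℝ → ℝ} (hχ : IsCutoff χ) (j : ℕ) (f : 𝓢'(ℝ, ℂ)) (x : ℝ) :
    lowFreq hχ j f x = (𝓕 f) (hχ.kernel j x) := rfl

theorem smulLeftCLM_weight_apply (σ : ℝ) (φ : 𝓢(ℝ, ℂ)) (x : ℝ) :
    SchwartzMap.smulLeftCLM ℂ (weight σ) φ x = (wt σ x : ℂ) * φ x := by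
  rw [SchwartzMap.smulLeftCLM_apply_apply (weight_hasTemperateGrowth σ), weight_eq, smul_eq_mul]

theorem smulLeftCLM_weight_weight_neg (σ : ℝ) (φ : 𝓢(ℝ, ℂ)) :
    SchwartzMap.smulLeftCLM ℂ (weight σ) (SchwartzMap.smulLeftCLM ℂ (weight (-σ)) φ) = φ := by
  ext x
  rw [smulLeftCLM_weight_apply, smulLeftCLM_weight_apply, ← mul_assoc, ← Complex.ofReal_mul,
    wt_mul_wt_neg, Complex.ofReal_one, one_mul]

/-- A distribution with a weighted `L²` density is evaluated by an integral. -/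
theorem apply_eq_integral_of_smulLeftCLM_eq {σ : ℝ} {h : 𝓢'(ℝ, ℂ)}
    {U : Lp ℂ 2 (volume : Measure ℝ)}
    (hU : TemperedDistribution.smulLeftCLM ℂ (weight σ) h = (U : 𝓢'(ℝ, ℂ))) (φ : 𝓢(ℝ, ℂ)) :
    h φ = ∫ ξ, φ ξ * ((wt (-σ) ξ : ℂ) * U ξ) := by
  have e := DFunLike.congr_fun hU (SchwartzMap.smulLeftCLM ℂ (weight (-σ)) φ)
  rw [TemperedDistribution.smulLeftCLM_apply_apply, smulLeftCLM_weight_weight_neg,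
    Lp.toTemperedDistribution_apply] at e
  rw [e]
  congr 1 with ξ
  rw [smulLeftCLM_weight_apply, smul_eq_mul]
  ring

theorem lowFreq_eq_fourierInv {χ : ℝ → ℝ} (hχ : IsCutoff χ) (j : ℕ) {σ : ℝ} {g : 𝓢'(ℝ, ℂ)}
    {U : Lp ℂ 2 (volume : Measure ℝ)}
    (hU : TemperedDistribution.smulLeftCLM ℂ (weight σ) (𝓕 g) = (U : 𝓢'(ℝ, ℂ))) (x : ℝ) :
    lowFreq hχ j g x =
      𝓕⁻ (fun ξ => (χ ((2 ^ j : ℝ)⁻¹ * ξ) : ℂ) * ((wt (-σ) ξ : ℂ) * U ξ)) x := by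
  rw [lowFreq_eq, apply_eq_integral_of_smulLeftCLM_eq hU, fourierInv_eq_chr]
  congr 1 with ξ
  rw [hχ.kernel_apply]
  ring

open LineDeriv in
theorem neg_derivCLM_fourier (ψ ψ' : 𝓢(ℝ, ℂ))
    (h : ∀ ξ, ψ' ξ = 2 * Real.pi * Complex.I * ξ * ψ ξ) :
    -SchwartzMap.derivCLM ℂ ℂ (𝓕 ψ) = 𝓕 ψ' := by
  have e1 : SchwartzMap.derivCLM ℂ ℂ (𝓕 ψ) = ∂_{(1 : ℝ)} (𝓕 ψ) := by
    ext x
    simp [SchwartzMap.lineDerivOp_apply_eq_fderiv]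
  have hg : (fun x : ℝ => inner ℝ x (1 : ℝ)).HasTemperateGrowth := by fun_prop
  have e2 : (2 * Real.pi * Complex.I) •
      SchwartzMap.smulLeftCLM ℂ (fun x : ℝ => inner ℝ x (1 : ℝ)) ψ = ψ' := by
    ext x
    rw [smul_apply, SchwartzMap.smulLeftCLM_apply_apply hg, h]
    simp
    ring
  rw [e1, SchwartzMap.lineDerivOp_fourier_eq, neg_smul, e2, FourierTransform.fourier_neg,
    neg_neg]

/-- This is `𝓕 f' = 2πiξ 𝓕 f` in dual form. Having `ψ'` as a separate test function allows it to be
used for division by `ξ`. -/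
theorem fourier_derivCLM_apply (f : 𝓢'(ℝ, ℂ)) (ψ ψ' : 𝓢(ℝ, ℂ))
    (h : ∀ ξ, ψ' ξ = 2 * Real.pi * Complex.I * ξ * ψ ξ) :
    𝓕 (TemperedDistribution.derivCLM ℂ f) ψ = 𝓕 f ψ' := by
  rw [TemperedDistribution.fourier_apply, TemperedDistribution.derivCLM_apply_apply,
    neg_derivCLM_fourier ψ ψ' h, TemperedDistribution.fourier_apply]

/-- The multiplier `(χ (2^{-j} ξ) - χ₀ ξ) / (2πiξ)`. -/
def diffQuot (χ χ₀ : ℝ → ℝ) (j : ℕ) (ξ : ℝ) : ℂ :=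
  ((χ ((2 ^ j : ℝ)⁻¹ * ξ) - χ₀ ξ : ℝ) : ℂ) / (2 * Real.pi * Complex.I * ξ)

theorem two_pow_inv_mul_le (j : ℕ) (ξ : ℝ) : |(2 ^ j : ℝ)⁻¹ * ξ| ≤ |ξ| := by
  rw [abs_mul, abs_of_pos (by positivity)]
  exact mul_le_of_le_one_left (abs_nonneg _) (inv_le_one_of_one_le₀ (one_le_pow₀ (by norm_num)))

/-- One `δ` serves all `j`, since the dilation by `2^{-j}` only moves points closer to zero. -/
theorem IsCutoff.exists_sub_eq_zero {χ χ₀ : ℝ → ℝ} (hχ : IsCutoff χ) (hχ₀ : IsCutoff χ₀) :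
    ∃ δ : ℝ, 0 < δ ∧ ∀ (j : ℕ) (ξ : ℝ), |ξ| < δ → χ ((2 ^ j : ℝ)⁻¹ * ξ) - χ₀ ξ = 0 := by
  obtain ⟨δ, hδ, h⟩ := Metric.eventually_nhds_iff.1 (hχ.eq_one.and hχ₀.eq_one)
  refine ⟨δ, hδ, fun j ξ hξ => ?_⟩
  have h1 := (@h ((2 ^ j : ℝ)⁻¹ * ξ)
    (by rw [Real.dist_eq, sub_zero]; exact (two_pow_inv_mul_le j ξ).trans_lt hξ)).1
  have h2 := (@h ξ (by rwa [Real.dist_eq, sub_zero])).2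
  rw [h1, h2]; simp

theorem diffQuot_mul {χ χ₀ : ℝ → ℝ} (hχ : IsCutoff χ) (hχ₀ : IsCutoff χ₀) (j : ℕ) (ξ : ℝ) :
    2 * Real.pi * Complex.I * ξ * diffQuot χ χ₀ j ξ =
      ((χ ((2 ^ j : ℝ)⁻¹ * ξ) - χ₀ ξ : ℝ) : ℂ) := by
  unfold diffQuot
  rcases eq_or_ne ξ 0 with rfl | h
  · obtain ⟨δ, hδ, h⟩ := hχ.exists_sub_eq_zero hχ₀
    rw [h j 0 (by simpa using hδ), Complex.ofReal_zero, zero_div, mul_zero]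
  · have h1 : (2 * Real.pi * Complex.I * ξ : ℂ) ≠ 0 := by
      simp [h, Real.pi_ne_zero]
    exact mul_div_cancel₀ _ h1

theorem contDiff_diffQuot {χ χ₀ : ℝ → ℝ} (hχ : IsCutoff χ) (hχ₀ : IsCutoff χ₀) (j : ℕ) :
    ContDiff ℝ ∞ (diffQuot χ χ₀ j) := by
  rw [contDiff_iff_contDiffAt]
  intro ξ
  rcases eq_or_ne ξ 0 with rfl | h
  · obtain ⟨δ, hδ, h⟩ := hχ.exists_sub_eq_zero hχ₀
    have : diffQuot χ χ₀ j =ᶠ[𝓝 0] fun _ => 0 := by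
      filter_upwards [Metric.ball_mem_nhds (0 : ℝ) hδ] with ξ hξ
      rw [Metric.mem_ball, Real.dist_eq, sub_zero] at hξ
      simp [diffQuot, h j ξ hξ]
    exact contDiffAt_const.congr_of_eventuallyEq this
  · have h1 : (2 * Real.pi * Complex.I * ξ : ℂ) ≠ 0 := by
      simp [h, Real.pi_ne_zero]
    have h2 : ContDiff ℝ ∞ fun ξ : ℝ => χ ((2 ^ j : ℝ)⁻¹ * ξ) - χ₀ ξ :=
      (hχ.smooth.comp (by fun_prop)).sub hχ₀.smooth
    have h3 : ContDiff ℝ ∞ fun ξ : ℝ => ((χ ((2 ^ j : ℝ)⁻¹ * ξ) - χ₀ ξ : ℝ) : ℂ) :=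
      Complex.ofRealCLM.contDiff.comp h2
    have h4 : ContDiff ℝ ∞ fun ξ : ℝ => (2 * Real.pi * Complex.I * ξ : ℂ) :=
      contDiff_const.mul Complex.ofRealCLM.contDiff
    unfold diffQuot
    simp only [div_eq_mul_inv]
    exact h3.contDiffAt.mul (h4.contDiffAt.inv h1)

theorem hasCompactSupport_diffQuot {χ χ₀ : ℝ → ℝ} (hχ : IsCutoff χ) (hχ₀ : IsCutoff χ₀) (j : ℕ) :
    HasCompactSupport (diffQuot χ χ₀ j) := by
  have h0 : ((2 ^ j : ℝ)⁻¹) ≠ 0 := by positivity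
  have h1 : HasCompactSupport fun ξ : ℝ => χ ((2 ^ j : ℝ)⁻¹ * ξ) - χ₀ ξ :=
    (hχ.compact.comp_homeomorph (Homeomorph.mulLeft₀ _ h0)).sub hχ₀.compact
  have h2 : HasCompactSupport fun ξ : ℝ => ((χ ((2 ^ j : ℝ)⁻¹ * ξ) - χ₀ ξ : ℝ) : ℂ) :=
    h1.comp_left (g := fun r : ℝ => (r : ℂ)) Complex.ofReal_zero
  unfold diffQuot
  simp only [div_eq_mul_inv]
  exact h2.mul_right

theorem IsCutoff.exists_norm_le {χ : ℝ → ℝ} (hχ : IsCutoff χ) :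
    ∃ D : ℝ, 0 ≤ D ∧ ∀ ξ, |χ ξ| ≤ D := by
  obtain ⟨D, hD⟩ := hχ.smooth.continuous.bounded_above_of_compact_support hχ.compact
  exact ⟨D, (norm_nonneg _).trans (hD 0), hD⟩

/-- The gain of one derivative, uniform in `j`: below `δ` the numerator vanishes, above it `2π|ξ|`
is comparable to the weight. This is what lifts `f'` in `H^{s-1}` to a high part in `H^s`. -/
theorem exists_norm_diffQuot_le {χ χ₀ : ℝ → ℝ} (hχ : IsCutoff χ) (hχ₀ : IsCutoff χ₀) :
    ∃ D : ℝ, 0 ≤ D ∧ ∀ (j : ℕ) (ξ : ℝ), ‖diffQuot χ χ₀ j ξ‖ ≤ D * wt (-1) ξ := by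
  obtain ⟨δ, hδ, h⟩ := hχ.exists_sub_eq_zero hχ₀
  obtain ⟨D₁, hD₁, h₁⟩ := hχ.exists_norm_le
  obtain ⟨D₂, hD₂, h₂⟩ := hχ₀.exists_norm_le
  refine ⟨(D₁ + D₂) * (1 + 1 / (2 * Real.pi * δ)), by positivity, fun j ξ => ?_⟩
  have pw := wt_pos (-1) ξ
  rcases lt_or_ge |ξ| δ with hξ | hξ
  · rw [diffQuot, h j ξ hξ]
    simp only [Complex.ofReal_zero, zero_div, norm_zero]
    positivity
  · have hξ0 : 0 < |ξ| := hδ.trans_le hξ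
    have e1 : ‖diffQuot χ χ₀ j ξ‖ = |χ ((2 ^ j : ℝ)⁻¹ * ξ) - χ₀ ξ| / (2 * Real.pi * |ξ|) := by
      simp [diffQuot, abs_of_pos Real.pi_pos, -Complex.ofReal_sub]
    have e2 : |χ ((2 ^ j : ℝ)⁻¹ * ξ) - χ₀ ξ| ≤ D₁ + D₂ :=
      (abs_sub _ _).trans (add_le_add (h₁ _) (h₂ _))
    have e3 : wt 1 ξ ≤ 1 + 2 * Real.pi * |ξ| := by
      rw [wt, ← Real.sqrt_eq_rpow]
      apply Real.sqrt_le_iff.2 ⟨by positivity, _⟩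
      rw [Real.norm_eq_abs, abs_mul, abs_of_pos (by positivity : 0 < 2 * Real.pi)]
      nlinarith [mul_pos (mul_pos two_pos Real.pi_pos) hξ0]
    have e4 : wt 1 ξ ≤ (1 + 1 / (2 * Real.pi * δ)) * (2 * Real.pi * |ξ|) := by
      have : 1 ≤ 1 / (2 * Real.pi * δ) * (2 * Real.pi * |ξ|) := by
        rw [one_div_mul_eq_div, one_le_div (by positivity)]
        gcongr
      linarith
    rw [e1, div_le_iff₀ (by positivity)]
    calc |χ ((2 ^ j : ℝ)⁻¹ * ξ) - χ₀ ξ| ≤ (D₁ + D₂) * (wt (-1) ξ * wt 1 ξ) := by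
          rw [wt_neg_mul_wt, mul_one]; exact e2
      _ ≤ (D₁ + D₂) * (wt (-1) ξ * ((1 + 1 / (2 * Real.pi * δ)) * (2 * Real.pi * |ξ|))) := by
          gcongr
      _ = _ := by ring

/-- If `f'` has a weighted `L²` density, then the difference of two low-frequency parts of `f`
is the inverse Fourier transform of an explicit function. -/
theorem lowFreq_eq_add_fourierInv {χ χ₀ : ℝ → ℝ} (hχ : IsCutoff χ) (hχ₀ : IsCutoff χ₀) (j : ℕ)
    {σ : ℝ} {f : 𝓢'(ℝ, ℂ)} {U : Lp ℂ 2 (volume : Measure ℝ)}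
    (hU : TemperedDistribution.smulLeftCLM ℂ (weight σ)
      (𝓕 (TemperedDistribution.derivCLM ℂ f)) = (U : 𝓢'(ℝ, ℂ))) (x : ℝ) :
    lowFreq hχ j f x = lowFreq hχ₀ 0 f x +
      𝓕⁻ (fun ξ => diffQuot χ χ₀ j ξ * ((wt (-σ) ξ : ℂ) * U ξ)) x := by
  -- The quotient times the character is a test function `Q`, and `2πiξ Q` is the difference of the
  -- two kernels. Pairing `𝓕 f'` with `Q` therefore gives the difference of the low-frequency parts.
  have hc : HasCompactSupport fun ξ => diffQuot χ χ₀ j ξ * chr x ξ :=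
    (hasCompactSupport_diffQuot hχ hχ₀ j).mul_right
  have hs : ContDiff ℝ ∞ fun ξ => diffQuot χ χ₀ j ξ * chr x ξ := by
    refine (contDiff_diffQuot hχ hχ₀ j).mul ?_
    have h3 : ContDiff ℝ ∞ (fun ξ : ℝ ↦ (ξ : ℂ)) := Complex.ofRealCLM.contDiff
    exact Complex.contDiff_exp.comp (contDiff_const.mul h3)
  set Q : 𝓢(ℝ, ℂ) := hc.toSchwartzMap hs
  have hQ : ∀ ξ, Q ξ = diffQuot χ χ₀ j ξ * chr x ξ := fun ξ => rfl
  have e1 : 𝓕 (TemperedDistribution.derivCLM ℂ f) Q = 𝓕 f (hχ.kernel j x - hχ₀.kernel 0 x) := by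
    apply fourier_derivCLM_apply
    intro ξ
    rw [hQ, ← mul_assoc, diffQuot_mul hχ hχ₀, sub_apply, hχ.kernel_apply,
      hχ₀.kernel_apply]
    push_cast
    simp
    ring
  rw [map_sub, apply_eq_integral_of_smulLeftCLM_eq hU] at e1
  rw [lowFreq_eq, lowFreq_eq, ← sub_eq_iff_eq_add', ← e1, fourierInv_eq_chr]
  congr 1 with ξ
  rw [hQ]
  ring

/-- The low-frequency part of a bounded function is a convolution. -/
theorem lowFreq_eq_lowPass {χ : ℝ → ℝ} (hχ : IsCutoff χ) (u : Lp ℂ ∞ (volume : Measure ℝ))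
    (x : ℝ) : lowFreq hχ 0 (u : 𝓢'(ℝ, ℂ)) x = lowPass (hχ.kernel 0 0) u x := by
  rw [lowFreq_eq, TemperedDistribution.fourier_apply, Lp.toTemperedDistribution_apply, lowPass]
  congr 1 with y
  have e : (hχ.kernel 0 x : ℝ → ℂ) = fun ξ => chr x ξ * hχ.kernel 0 0 ξ := by
    ext ξ
    rw [hχ.kernel_apply, hχ.kernel_apply]
    have : chr 0 ξ = 1 := by simp [chr]
    rw [this]; ring
  rw [SchwartzMap.fourier_coe, SchwartzMap.fourier_coe, e, fourier_chr_mul, smul_eq_mul, mul_comm]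

/-! ### Duality -/

/-- Functionals on Schwartz functions that are bounded in the `L²` norm are given by `L²`
functions. -/
theorem exists_Lp_of_bound (T : 𝓢(ℝ, ℂ) →ₗ[ℂ] ℂ) (M : ℝ≥0)
    (hT : ∀ ψ : 𝓢(ℝ, ℂ), ‖T ψ‖ ≤ M * ‖ψ.toLp 2 (volume : Measure ℝ)‖) :
    ∃ U : Lp ℂ 2 (volume : Measure ℝ), ‖U‖ ≤ M ∧ ∀ ψ, T ψ = (U : 𝓢'(ℝ, ℂ)) ψ := by
  set e : 𝓢(ℝ, ℂ) →L[ℂ] Lp ℂ 2 (volume : Measure ℝ) := SchwartzMap.toLpCLM ℂ ℂ 2 volume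
  have hd : DenseRange e := SchwartzMap.denseRange_toLpCLM ENNReal.ofNat_ne_top
  set L : Lp ℂ 2 (volume : Measure ℝ) →L[ℂ] ℂ := T.extendOfNorm e.toLinearMap with hL
  have hLT : ∀ ψ, L (ψ.toLp 2 volume) = T ψ := fun ψ =>
    LinearMap.extendOfNorm_eq (f := T) (e := e.toLinearMap) hd ⟨M, hT⟩ ψ
  have hLn : ‖L‖ ≤ M :=
    LinearMap.opNorm_extendOfNorm_le (f := T) (e := e.toLinearMap) hd M.coe_nonneg hT
  set w := (InnerProductSpace.toDual ℂ (Lp ℂ 2 (volume : Measure ℝ))).symm L with hw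
  -- The inner product conjugates `w`, the pairing with distributions does not; hence the conjugate
  -- of the Riesz representative.
  refine ⟨star w, ?_, fun ψ => ?_⟩
  · have h1 : ‖star w‖ ≤ ‖w‖ := Lp.norm_le_norm_of_ae_le <| by
      filter_upwards [Lp.coeFn_star w] with x hx
      rw [hx, Pi.star_apply, norm_star]
    refine h1.trans ?_
    rw [hw, LinearIsometryEquiv.norm_map]
    exact hLn
  · rw [← hLT, ← InnerProductSpace.toDual_symm_apply, ← hw, L2.inner_def,
      Lp.toTemperedDistribution_apply]
    apply integral_congr_ae
    filter_upwards [ψ.coeFn_toLp 2 volume, Lp.coeFn_star w] with x h1 h2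
    rw [h1, h2]
    simp

theorem enorm_toLp_eq (ψ : 𝓢(ℝ, ℂ)) :
    ‖ψ.toLp 2 (volume : Measure ℝ)‖ₑ = l2 fun x => ‖ψ x‖ₑ := by
  rw [Lp.enorm_def, eLpNorm_congr_ae (ψ.coeFn_toLp 2 volume), eLpNorm_two_eq_l2]

theorem l2_wt_schwartz_eq (σ : ℝ) (ψ : 𝓢(ℝ, ℂ)) :
    l2 (fun x => ENNReal.ofReal (wt σ x) * ‖ψ x‖ₑ) =
      ‖(SchwartzMap.smulLeftCLM ℂ (weight σ) ψ).toLp 2 (volume : Measure ℝ)‖ₑ := by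
  rw [enorm_toLp_eq]
  congr 1 with x
  rw [smulLeftCLM_weight_apply, enorm_mul, ← ofReal_norm (wt σ x : ℂ), Complex.norm_real,
    Real.norm_of_nonneg (wt_pos _ _).le]

/-- Duality between `H^σ` and `H^{-σ}`. -/
theorem exists_sobolevNorm_le_of_bound {σ : ℝ} (b : 𝓢(ℝ, ℂ) →ₗ[ℂ] ℂ) (M : ℝ≥0)
    (hb : ∀ Φ : 𝓢(ℝ, ℂ), ‖b (𝓕 Φ)‖ₑ ≤ M * l2 fun x => ENNReal.ofReal (wt (-σ) x) * ‖Φ x‖ₑ) :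
    ∃ h : 𝓢'(ℝ, ℂ), (∀ φ, h φ = b φ) ∧ sobolevNorm σ h ≤ M := by
  -- Inserting the weight before the Fourier transform turns the `H^{-σ}` bound into a plain `L²`
  -- bound.
  set T : 𝓢(ℝ, ℂ) →ₗ[ℂ] ℂ := b ∘ₗ (FourierTransform.fourierₗ ℂ 𝓢(ℝ, ℂ)) ∘ₗ
    (SchwartzMap.smulLeftCLM ℂ (weight σ)).toLinearMap
  have hTb : ∀ ψ, T ψ = b (𝓕 (SchwartzMap.smulLeftCLM ℂ (weight σ) ψ)) := fun ψ => rfl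
  obtain ⟨U, hU, hTU⟩ := exists_Lp_of_bound T M fun ψ => by
    have h := hb (SchwartzMap.smulLeftCLM ℂ (weight σ) ψ)
    have e := smulLeftCLM_weight_weight_neg (-σ) ψ
    rw [neg_neg] at e
    rw [l2_wt_schwartz_eq, e, ← hTb] at h
    rw [← ofReal_norm, ← ofReal_norm (ψ.toLp 2 volume), ← ENNReal.ofReal_coe_nnreal,
      ← ENNReal.ofReal_mul M.coe_nonneg] at h
    exact (ENNReal.ofReal_le_ofReal_iff (by positivity)).1 h
  set V : 𝓢'(ℝ, ℂ) := TemperedDistribution.smulLeftCLM ℂ (weight (-σ)) (U : 𝓢'(ℝ, ℂ)) with hV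
  refine ⟨𝓕⁻ V, fun φ => ?_, ?_⟩
  · rw [TemperedDistribution.fourierInv_apply, hV, TemperedDistribution.smulLeftCLM_apply_apply,
      ← hTU, hTb, smulLeftCLM_weight_weight_neg, FourierTransform.fourier_fourierInv_eq]
  · refine (iInf₂_le U ?_).trans ?_
    · rw [FourierTransform.fourier_fourierInv_eq, hV]
      ext φ
      have := smulLeftCLM_weight_weight_neg (-σ) φ
      rw [neg_neg] at this
      rw [TemperedDistribution.smulLeftCLM_apply_apply,
        TemperedDistribution.smulLeftCLM_apply_apply, this]
    · rw [← ofReal_norm, ← ENNReal.ofReal_coe_nnreal]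
      exact ENNReal.ofReal_le_ofReal hU

/-! ### Truncated densities -/

theorem memLp_cutoff_mul {k : ℝ → ℂ} (hk : Continuous k) (hc : HasCompactSupport k)
    (U : Lp ℂ 2 (volume : Measure ℝ)) : MemLp (fun ξ => k ξ * U ξ) 2 := by
  obtain ⟨D, hD⟩ := hk.bounded_above_of_compact_support hc
  refine MemLp.of_le_mul (c := D) (Lp.memLp U)
    (hk.aestronglyMeasurable.mul (Lp.aestronglyMeasurable U)) (ae_of_all _ fun x => ?_)
  rw [norm_mul]
  gcongr
  exact hD x

theorem integrable_cutoff_mul {k : ℝ → ℂ} (hk : Continuous k) (hc : HasCompactSupport k)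
    (U : Lp ℂ 2 (volume : Measure ℝ)) : Integrable fun ξ => k ξ * U ξ := by
  have h := (hk.memLp_of_hasCompactSupport (p := 2) (μ := volume) hc).integrable_mul (Lp.memLp U)
  exact h

/-- The frequency-localised density `χ (2^{-j} ξ) ⟨2πξ⟩^{-σ} U ξ`. -/
def lowDensity (χ : ℝ → ℝ) (j : ℕ) (σ : ℝ) (U : ℝ → ℂ) (ξ : ℝ) : ℂ :=
  (χ ((2 ^ j : ℝ)⁻¹ * ξ) : ℂ) * ((wt (-σ) ξ : ℂ) * U ξ)

/-- The density of the difference of two low-frequency parts. -/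
def highDensity (χ χ₀ : ℝ → ℝ) (j : ℕ) (σ : ℝ) (U : ℝ → ℂ) (ξ : ℝ) : ℂ :=
  diffQuot χ χ₀ j ξ * ((wt (-σ) ξ : ℂ) * U ξ)

theorem continuous_ofReal_wt (σ : ℝ) : Continuous fun ξ => (wt σ ξ : ℂ) :=
  Complex.continuous_ofReal.comp (continuous_wt σ)

theorem IsCutoff.continuous_dil {χ : ℝ → ℝ} (hχ : IsCutoff χ) (j : ℕ) :
    Continuous fun ξ : ℝ => (χ ((2 ^ j : ℝ)⁻¹ * ξ) : ℂ) :=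
  Complex.continuous_ofReal.comp (hχ.smooth.continuous.comp (by fun_prop))

theorem IsCutoff.hasCompactSupport_dil {χ : ℝ → ℝ} (hχ : IsCutoff χ) (j : ℕ) :
    HasCompactSupport fun ξ : ℝ => (χ ((2 ^ j : ℝ)⁻¹ * ξ) : ℂ) := by
  have h0 : ((2 ^ j : ℝ)⁻¹) ≠ 0 := by positivity
  exact (hχ.compact.comp_homeomorph (Homeomorph.mulLeft₀ _ h0)).comp_left
    (g := fun r : ℝ => (r : ℂ)) Complex.ofReal_zero

theorem IsCutoff.tendsto_dil {χ : ℝ → ℝ} (hχ : IsCutoff χ) (ξ : ℝ) :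
    Tendsto (fun j : ℕ => χ ((2 ^ j : ℝ)⁻¹ * ξ)) atTop (𝓝 1) := by
  have h1 : Tendsto (fun j : ℕ => (2 ^ j : ℝ)⁻¹ * ξ) atTop (𝓝 0) := by
    have := (tendsto_pow_atTop_nhds_zero_of_lt_one (r := (2 : ℝ)⁻¹) (by norm_num)
      (by norm_num)).mul_const ξ
    simpa [inv_pow] using this
  have h2 : χ 0 = 1 := hχ.eq_one.eq_of_nhds
  have h3 := (hχ.smooth.continuous.tendsto 0).comp h1
  rwa [h2] at h3

theorem memLp_lowDensity {χ : ℝ → ℝ} (hχ : IsCutoff χ) (j : ℕ) (σ : ℝ)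
    (U : Lp ℂ 2 (volume : Measure ℝ)) : MemLp (lowDensity χ j σ U) 2 := by
  have := memLp_cutoff_mul ((hχ.continuous_dil j).mul (continuous_ofReal_wt (-σ)))
    (hχ.hasCompactSupport_dil j).mul_right U
  unfold lowDensity
  simpa only [← mul_assoc, Pi.mul_apply] using this

theorem integrable_lowDensity {χ : ℝ → ℝ} (hχ : IsCutoff χ) (j : ℕ) (σ : ℝ)
    (U : Lp ℂ 2 (volume : Measure ℝ)) : Integrable (lowDensity χ j σ U) := by
  have := integrable_cutoff_mul ((hχ.continuous_dil j).mul (continuous_ofReal_wt (-σ)))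
    (hχ.hasCompactSupport_dil j).mul_right U
  unfold lowDensity
  simpa only [← mul_assoc, Pi.mul_apply] using this

theorem integrable_highDensity {χ χ₀ : ℝ → ℝ} (hχ : IsCutoff χ) (hχ₀ : IsCutoff χ₀) (j : ℕ)
    (σ : ℝ) (U : Lp ℂ 2 (volume : Measure ℝ)) : Integrable (highDensity χ χ₀ j σ U) := by
  have := integrable_cutoff_mul
    ((contDiff_diffQuot hχ hχ₀ j).continuous.mul (continuous_ofReal_wt (-σ)))
    (hasCompactSupport_diffQuot hχ hχ₀ j).mul_right U
  unfold highDensity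
  simpa only [← mul_assoc, Pi.mul_apply] using this

theorem measurable_Lp (U : Lp ℂ 2 (volume : Measure ℝ)) : Measurable U :=
  (Lp.stronglyMeasurable U).measurable

theorem measurable_lowDensity {χ : ℝ → ℝ} (hχ : IsCutoff χ) (j : ℕ) (σ : ℝ)
    (U : Lp ℂ 2 (volume : Measure ℝ)) : Measurable (lowDensity χ j σ U) :=
  (hχ.continuous_dil j).measurable.mul
    ((continuous_ofReal_wt (-σ)).measurable.mul (measurable_Lp U))

theorem measurable_highDensity {χ χ₀ : ℝ → ℝ} (hχ : IsCutoff χ) (hχ₀ : IsCutoff χ₀) (j : ℕ)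
    (σ : ℝ) (U : Lp ℂ 2 (volume : Measure ℝ)) : Measurable (highDensity χ χ₀ j σ U) :=
  (contDiff_diffQuot hχ hχ₀ j).continuous.measurable.mul
    ((continuous_ofReal_wt (-σ)).measurable.mul (measurable_Lp U))

theorem enorm_Lp_eq_l2 (U : Lp ℂ 2 (volume : Measure ℝ)) : ‖U‖ₑ = l2 fun x => ‖U x‖ₑ := by
  rw [Lp.enorm_def, eLpNorm_two_eq_l2]

theorem exists_norm_highDensity_le {χ χ₀ : ℝ → ℝ} (hχ : IsCutoff χ) (hχ₀ : IsCutoff χ₀) (s : ℝ) :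
    ∃ D : ℝ, 0 ≤ D ∧ ∀ (j : ℕ) (U : ℝ → ℂ) (ξ : ℝ),
      ‖highDensity χ χ₀ j (s - 1) U ξ‖ ≤ D * (wt (-s) ξ * ‖U ξ‖) := by
  obtain ⟨D, hD, h⟩ := exists_norm_diffQuot_le hχ hχ₀
  refine ⟨D, hD, fun j U ξ => ?_⟩
  have e : wt (-s) ξ = wt (-1) ξ * wt (-(s - 1)) ξ := by rw [← wt_add]; congr 1; ring
  rw [highDensity, norm_mul, norm_mul, Complex.norm_real, Real.norm_of_nonneg (wt_pos _ _).le, e]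
  have := wt_pos (-(s - 1)) ξ
  calc _ ≤ D * wt (-1) ξ * (wt (-(s - 1)) ξ * ‖U ξ‖) := by gcongr; exact h j ξ
    _ = _ := by ring

theorem norm_lowDensity_le {χ : ℝ → ℝ} {D : ℝ} (hD : ∀ ξ, |χ ξ| ≤ D) (j : ℕ) (σ : ℝ)
    (U : ℝ → ℂ) (ξ : ℝ) : ‖lowDensity χ j σ U ξ‖ ≤ D * (wt (-σ) ξ * ‖U ξ‖) := by
  rw [lowDensity, norm_mul, norm_mul, Complex.norm_real, Complex.norm_real,
    Real.norm_of_nonneg (wt_pos _ _).le]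
  have := wt_pos (-σ) ξ
  gcongr
  exact hD _

/-! ### Limits of the two parts of the product -/

/-- The high-frequency part of the product: limit and bound. -/
theorem exists_high_limit {s σ : ℝ} (hs : 1 / 2 < s) (hσ : |σ| ≤ s) {χ₀ : ℝ → ℝ}
    (hχ₀ : IsCutoff χ₀) : ∃ C : ℝ≥0, ∀ (F G : Lp ℂ 2 (volume : Measure ℝ)) (Φ : 𝓢(ℝ, ℂ)),
      ∃ ℓ : ℂ, ‖ℓ‖ₑ ≤ C * (‖F‖ₑ * ‖G‖ₑ * l2 fun x => ENNReal.ofReal (wt (-σ) x) * ‖Φ x‖ₑ) ∧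
        ∀ χ : ℝ → ℝ, IsCutoff χ → Tendsto (fun j : ℕ =>
          ∫ x, 𝓕⁻ (highDensity χ χ₀ j (s - 1) F) x *
            (𝓕⁻ (lowDensity χ j σ G) x * (𝓕 Φ : 𝓢(ℝ, ℂ)) x)) atTop (𝓝 ℓ) := by
  obtain ⟨C, hC⟩ := exists_lintegral_kernel_le hs hσ
  obtain ⟨D₁, hD₁, h₁⟩ := exists_norm_highDensity_le hχ₀ hχ₀ s
  obtain ⟨D₂, hD₂, h₂⟩ := hχ₀.exists_norm_le
  refine ⟨(D₁ * D₂).toNNReal * C, fun F G Φ => ?_⟩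
  set N : ℝ≥0∞ := l2 fun x => ENNReal.ofReal (wt (-σ) x) * ‖Φ x‖ₑ with hN
  -- Up to constants depending on the cutoffs, `k` dominates the integrand for every `j`; its
  -- integrability is the trilinear estimate.
  set k : ℝ × ℝ → ℝ := fun p => wt (-s) p.1 * ‖F p.1‖ * (wt (-σ) p.2 * ‖G p.2‖) *
    ‖Φ (p.1 + p.2)‖ with hk
  have mk : Measurable k := by
    have m1 := (continuous_wt (-s)).comp (continuous_fst (X := ℝ) (Y := ℝ)) |>.measurable
    have m2 := (continuous_wt (-σ)).comp (continuous_snd (X := ℝ) (Y := ℝ)) |>.measurable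
    have m3 : Measurable fun p : ℝ × ℝ => ‖F p.1‖ := (measurable_Lp F).norm.comp measurable_fst
    have m4 : Measurable fun p : ℝ × ℝ => ‖G p.2‖ := (measurable_Lp G).norm.comp measurable_snd
    have m5 : Measurable fun p : ℝ × ℝ => ‖Φ (p.1 + p.2)‖ :=
      (Φ.continuous.norm.comp (by fun_prop)).measurable
    exact ((m1.mul m3).mul (m2.mul m4)).mul m5
  have k0 : ∀ p, 0 ≤ k p := fun p => by
    have := wt_pos (-s) p.1
    have := wt_pos (-σ) p.2
    positivity
  have hkC : ∫⁻ p, ENNReal.ofReal (k p) ≤ C * (‖F‖ₑ * ‖G‖ₑ * N) := by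
    rw [Measure.volume_eq_prod, lintegral_prod _ mk.ennreal_ofReal.aemeasurable,
      enorm_Lp_eq_l2, enorm_Lp_eq_l2]
    refine le_trans (le_of_eq ?_) (hC _ _ _ (measurable_Lp F).enorm (measurable_Lp G).enorm
      Φ.continuous.enorm.measurable)
    congr 1 with x
    congr 1 with y
    have p1 := wt_pos (-s) x
    have p2 := wt_pos (-σ) y
    simp only [hk]
    rw [ENNReal.ofReal_mul (by positivity), ENNReal.ofReal_mul (by positivity),
      ENNReal.ofReal_mul p1.le, ENNReal.ofReal_mul p2.le, ofReal_norm, ofReal_norm, ofReal_norm]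
  have hkfin : ∫⁻ p, ENNReal.ofReal (k p) < ⊤ := by
    refine hkC.trans_lt (ENNReal.mul_lt_top ENNReal.coe_lt_top
      (ENNReal.mul_lt_top (ENNReal.mul_lt_top enorm_lt_top enorm_lt_top) ?_))
    rw [hN, l2_wt_schwartz_eq]
    exact enorm_lt_top
  have hki : Integrable k := by
    refine ⟨mk.aestronglyMeasurable, ?_⟩
    rw [hasFiniteIntegral_iff_ofReal (ae_of_all _ k0)]
    exact hkfin
  set I : (ℝ → ℝ) → ℕ → ℝ × ℝ → ℂ := fun χ j p =>
    highDensity χ χ₀ j (s - 1) F p.1 * (lowDensity χ j σ G p.2 * Φ (p.1 + p.2)) with hI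
  have mI : ∀ {χ : ℝ → ℝ}, IsCutoff χ → ∀ j, Measurable (I χ j) := by
    intro χ hχ j
    exact ((measurable_highDensity hχ hχ₀ j _ F).comp measurable_fst).mul
      (((measurable_lowDensity hχ j σ G).comp measurable_snd).mul
        (Φ.continuous.comp (by fun_prop : Continuous fun p : ℝ × ℝ => p.1 + p.2)).measurable)
  have bI : ∀ {χ : ℝ → ℝ} {D D' : ℝ}, 0 ≤ D → (∀ (j : ℕ) (U : ℝ → ℂ) (ξ : ℝ),
      ‖highDensity χ χ₀ j (s - 1) U ξ‖ ≤ D * (wt (-s) ξ * ‖U ξ‖)) → (∀ ξ, |χ ξ| ≤ D') →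
      ∀ j p, ‖I χ j p‖ ≤ D * D' * k p := by
    intro χ D D' hD h h' j p
    have w1 := wt_pos (-s) p.1
    simp only [hI, hk]
    rw [norm_mul, norm_mul]
    calc _ ≤ D * (wt (-s) p.1 * ‖F p.1‖) * (D' * (wt (-σ) p.2 * ‖G p.2‖) * ‖Φ (p.1 + p.2)‖) := by
          gcongr
          · exact h j F p.1
          · exact norm_lowDensity_le h' j σ G p.2
      _ = _ := by ring
  have eI : ∀ {χ : ℝ → ℝ}, IsCutoff χ → ∀ j, ∫ x, 𝓕⁻ (highDensity χ χ₀ j (s - 1) F) x *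
      (𝓕⁻ (lowDensity χ j σ G) x * (𝓕 Φ : 𝓢(ℝ, ℂ)) x) = ∫ p, I χ j p := by
    intro χ hχ j
    obtain ⟨D, hD, h⟩ := exists_norm_highDensity_le hχ hχ₀ s
    obtain ⟨D', hD', h'⟩ := hχ.exists_norm_le
    have hi : Integrable (I χ j) := (hki.const_mul (D * D')).mono'
      (mI hχ j).aestronglyMeasurable (ae_of_all _ (bI hD h h' j))
    rw [integral_fourierInv_mul_fourierInv_mul_fourier (integrable_highDensity hχ hχ₀ j _ F)
      (integrable_lowDensity hχ j σ G), Measure.volume_eq_prod, integral_prod _ hi]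
  -- The pointwise limit, both dilated cutoffs being replaced by 1. It contains no `χ`, so the bound
  -- on its integral may be read off along `χ₀`, with a constant independent of `χ`.
  set J : ℝ × ℝ → ℂ := fun p =>
    ((1 - χ₀ p.1 : ℝ) : ℂ) / (2 * Real.pi * Complex.I * p.1) *
      ((wt (-(s - 1)) p.1 : ℂ) * F p.1) * (((wt (-σ) p.2 : ℂ) * G p.2) * Φ (p.1 + p.2)) with hJ
  have lim : ∀ χ : ℝ → ℝ, IsCutoff χ → Tendsto (fun j : ℕ =>
      ∫ x, 𝓕⁻ (highDensity χ χ₀ j (s - 1) F) x *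
        (𝓕⁻ (lowDensity χ j σ G) x * (𝓕 Φ : 𝓢(ℝ, ℂ)) x)) atTop (𝓝 (∫ p, J p)) := by
    intro χ hχ
    simp_rw [eI hχ]
    obtain ⟨D, hD, h⟩ := exists_norm_highDensity_le hχ hχ₀ s
    obtain ⟨D', hD', h'⟩ := hχ.exists_norm_le
    refine tendsto_integral_of_dominated_convergence (fun p => D * D' * k p)
      (fun j => (mI hχ j).aestronglyMeasurable) (hki.const_mul _)
      (fun j => ae_of_all _ (bI hD h h' j)) (ae_of_all _ fun p => ?_)
    have t1 := hχ.tendsto_dil p.1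
    have t2 := (Complex.continuous_ofReal.tendsto _).comp (hχ.tendsto_dil p.2)
    have t3 := (Complex.continuous_ofReal.tendsto _).comp (t1.sub_const (χ₀ p.1))
    have t4 := ((t3.div_const (2 * Real.pi * Complex.I * p.1)).mul_const
      ((wt (-(s - 1)) p.1 : ℂ) * F p.1)).mul
      ((t2.mul_const ((wt (-σ) p.2 : ℂ) * G p.2)).mul_const (Φ (p.1 + p.2)))
    rw [Complex.ofReal_one, one_mul] at t4
    exact t4
  refine ⟨∫ p, J p, ?_, lim⟩
  refine le_of_tendsto ((continuous_enorm.tendsto _).comp (lim χ₀ hχ₀))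
    (Eventually.of_forall fun j => ?_)
  simp only [Function.comp_def]
  rw [eI hχ₀]
  calc ‖∫ p, I χ₀ j p‖ₑ ≤ ∫⁻ p, ‖I χ₀ j p‖ₑ := enorm_integral_le_lintegral_enorm _
    _ ≤ ∫⁻ p, ENNReal.ofReal (D₁ * D₂) * ENNReal.ofReal (k p) := by
        refine lintegral_mono fun p => ?_
        rw [← ofReal_norm, ← ENNReal.ofReal_mul (by positivity)]
        exact ENNReal.ofReal_le_ofReal (bI hD₁ h₁ h₂ j p)
    _ = ENNReal.ofReal (D₁ * D₂) * ∫⁻ p, ENNReal.ofReal (k p) :=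
        lintegral_const_mul' _ _ ENNReal.ofReal_ne_top
    _ ≤ ENNReal.ofReal (D₁ * D₂) * (C * (‖F‖ₑ * ‖G‖ₑ * N)) := by gcongr
    _ = _ := by
        push_cast
        change ENNReal.ofReal _ * _ = ENNReal.ofReal _ * _ * _
        ring

/-- The error of the frequency truncation in `L²`. -/
def truncError (χ : ℝ → ℝ) (j : ℕ) (U : ℝ → ℂ) : ℝ≥0∞ :=
  eLpNorm (fun ξ => ((χ ((2 ^ j : ℝ)⁻¹ * ξ) - 1 : ℝ) : ℂ) * U ξ) 2

theorem measurable_truncError {χ : ℝ → ℝ} (hχ : IsCutoff χ) (j : ℕ)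
    (U : Lp ℂ 2 (volume : Measure ℝ)) :
    Measurable fun ξ => ((χ ((2 ^ j : ℝ)⁻¹ * ξ) - 1 : ℝ) : ℂ) * U ξ := by
  have h : Continuous fun ξ : ℝ => ((χ ((2 ^ j : ℝ)⁻¹ * ξ) - 1 : ℝ) : ℂ) :=
    Complex.continuous_ofReal.comp
      ((hχ.smooth.continuous.comp (by fun_prop)).sub continuous_const)
  exact h.measurable.mul (measurable_Lp U)

theorem tendsto_truncError {χ : ℝ → ℝ} (hχ : IsCutoff χ) (U : Lp ℂ 2 (volume : Measure ℝ)) :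
    Tendsto (fun j => truncError χ j U) atTop (𝓝 0) := by
  obtain ⟨D, hD, h⟩ := hχ.exists_norm_le
  simp only [truncError, eLpNorm_two_eq_l2]
  have key : Tendsto (fun j : ℕ =>
      ∫⁻ ξ, ‖((χ ((2 ^ j : ℝ)⁻¹ * ξ) - 1 : ℝ) : ℂ) * U ξ‖ₑ ^ (2 : ℝ)) atTop (𝓝 (∫⁻ _ : ℝ, 0)) := by
    refine tendsto_lintegral_of_dominated_convergence
      (fun ξ => (ENNReal.ofReal (D + 1) * ‖U ξ‖ₑ) ^ (2 : ℝ))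
      (fun j => (measurable_truncError hχ j U).enorm.pow_const _) (fun j => ae_of_all _ fun ξ => ?_)
      ?_ (ae_of_all _ fun ξ => ?_)
    · beta_reduce
      rw [enorm_mul, ← ofReal_norm (((χ ((2 ^ j : ℝ)⁻¹ * ξ) - 1 : ℝ) : ℂ)), Complex.norm_real]
      gcongr
      refine (norm_sub_le _ _).trans ?_
      simpa using h _
    · simp_rw [ENNReal.mul_rpow_of_nonneg _ _ (by norm_num : (0 : ℝ) ≤ 2)]
      rw [lintegral_const_mul' _ _ (by finiteness), ← l2_sq, ← enorm_Lp_eq_l2]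
      finiteness
    · have t := ((Complex.continuous_ofReal.tendsto _).comp
        ((hχ.tendsto_dil ξ).sub_const 1)).mul_const (U ξ)
      have t2 := (ENNReal.continuous_rpow_const (y := 2)).tendsto _ |>.comp
        ((continuous_enorm.tendsto _).comp t)
      simpa [Function.comp_def] using t2
  rw [lintegral_zero] at key
  have := (ENNReal.continuous_rpow_const (y := 1 / 2)).tendsto _ |>.comp key
  simpa [l2, Function.comp_def] using this

theorem exists_forall_eq_zero_of_hasCompactSupport {χ : ℝ → ℝ} (hχ : HasCompactSupport χ) :
    ∃ R : ℝ, ∀ ξ, R ≤ |ξ| → χ ξ = 0 := by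
  obtain ⟨R, hR⟩ := hχ.isCompact.isBounded.subset_ball (0 : ℝ)
  refine ⟨R, fun ξ hξ => image_eq_zero_of_notMem_tsupport fun h => ?_⟩
  have := hR h
  rw [Metric.mem_ball, Real.dist_eq, sub_zero] at this
  linarith

theorem exists_nat_lowDensity_eq_zero {χ : ℝ → ℝ} (hχ : IsCutoff χ) (j : ℕ) (σ : ℝ) (U : ℝ → ℂ) :
    ∃ N : ℕ, ∀ M : ℕ, N ≤ M → ∀ ξ, (M : ℝ) ≤ |ξ| → lowDensity χ j σ U ξ = 0 := by
  obtain ⟨R, hR⟩ := exists_forall_eq_zero_of_hasCompactSupport hχ.compact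
  obtain ⟨N, hN⟩ := exists_nat_ge (2 ^ j * R)
  refine ⟨N, fun M hM ξ hξ => ?_⟩
  have h1 : (N : ℝ) ≤ M := by exact_mod_cast hM
  rw [lowDensity, hR, Complex.ofReal_zero, zero_mul]
  rw [abs_mul, abs_of_pos (by positivity), ← div_eq_inv_mul, le_div_iff₀ (by positivity)]
  linarith

/-- The low-frequency part of the product: limit and bound. -/
theorem exists_low_limit (σ : ℝ) {χ₀ : ℝ → ℝ} (hχ₀ : IsCutoff χ₀)
    (hsupp : ∀ ξ, 1 ≤ |ξ| → χ₀ ξ = 0) : ∃ C : ℝ≥0, ∀ (f : ℝ → ℂ) (B : ℝ),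
      AEStronglyMeasurable f → (∀ᵐ x, ‖f x‖ ≤ B) →
      ∀ (G : Lp ℂ 2 (volume : Measure ℝ)) (Φ : 𝓢(ℝ, ℂ)),
      ∃ ℓ : ℂ, ‖ℓ‖ₑ ≤ C * (ENNReal.ofReal B * ‖G‖ₑ *
          l2 fun x => ENNReal.ofReal (wt (-σ) x) * ‖Φ x‖ₑ) ∧
        ∀ χ : ℝ → ℝ, IsCutoff χ → Tendsto (fun j : ℕ =>
          ∫ x, lowPass (hχ₀.kernel 0 0) f x *
            (𝓕⁻ (lowDensity χ j σ G) x * (𝓕 Φ : 𝓢(ℝ, ℂ)) x)) atTop (𝓝 ℓ) := by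
  obtain ⟨C, hC⟩ := exists_lowPass_bound σ (χ := hχ₀.kernel 0 0) fun x hx => by
    rw [hχ₀.kernel_apply]; simp [hsupp x hx]
  obtain ⟨D, hD, hDb⟩ := hχ₀.exists_norm_le
  refine ⟨C * D.toNNReal, fun f B hf hB G Φ => ?_⟩
  set N : ℝ≥0∞ := l2 fun x => ENNReal.ofReal (wt (-σ) x) * ‖Φ x‖ₑ with hN
  have hNfin : N ≠ ⊤ := by
    rw [hN, l2_wt_schwartz_eq]
    exact enorm_ne_top
  set f₀ := lowPass (hχ₀.kernel 0 0) f
  set b : (ℝ → ℝ) → ℕ → ℂ := fun χ j =>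
    ∫ x, f₀ x * (𝓕⁻ (lowDensity χ j σ G) x * (𝓕 Φ : 𝓢(ℝ, ℂ)) x) with hb
  have cancel : ∀ (c : ℂ) (ξ : ℝ), ENNReal.ofReal (wt σ ξ) * ‖c * ((wt (-σ) ξ : ℂ) * G ξ)‖ₑ =
      ‖c * G ξ‖ₑ := by
    intro c ξ
    rw [enorm_mul, enorm_mul, enorm_mul, ← ofReal_norm (wt (-σ) ξ : ℂ), Complex.norm_real,
      Real.norm_of_nonneg (wt_pos _ _).le]
    calc _ = (ENNReal.ofReal (wt σ ξ) * ENNReal.ofReal (wt (-σ) ξ)) * (‖c‖ₑ * ‖G ξ‖ₑ) := by ring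
      _ = _ := by
        rw [← ENNReal.ofReal_mul (wt_pos _ _).le, wt_mul_wt_neg, ENNReal.ofReal_one, one_mul]
  have hint : ∀ {χ : ℝ → ℝ}, IsCutoff χ → ∀ j, Integrable fun x =>
      f₀ x * (𝓕⁻ (lowDensity χ j σ G) x * (𝓕 Φ : 𝓢(ℝ, ℂ)) x) := by
    intro χ hχ j
    refine Integrable.bdd_mul (integrable_bdd_mul_schwartz
      (continuous_fourierInv (integrable_lowDensity hχ j σ G)).aestronglyMeasurable
      (norm_fourierInv_le _) _) (aestronglyMeasurable_lowPass _ hf)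
      (ae_of_all _ (norm_lowPass_le _ hB))
  -- Two cutoffs at two scales are compared at once: `χ = χ' = χ₀` yields the Cauchy property, and
  -- `j = k` yields independence of the cutoff.
  have hdiff : ∀ {χ χ' : ℝ → ℝ}, IsCutoff χ → IsCutoff χ' → ∀ j k,
      edist (b χ j) (b χ' k) ≤
        C * ENNReal.ofReal B * N * truncError χ j G + C * ENNReal.ofReal B * N * truncError χ' k G := by
    intro χ χ' hχ hχ' j k
    obtain ⟨N₁, h₁⟩ := exists_nat_lowDensity_eq_zero hχ j σ G
    obtain ⟨N₂, h₂⟩ := exists_nat_lowDensity_eq_zero hχ' k σ G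
    have i₁ := integrable_lowDensity hχ j σ G
    have i₂ := integrable_lowDensity hχ' k σ G
    have hsub : b χ j - b χ' k = ∫ x, f₀ x *
        (𝓕⁻ (fun ξ => lowDensity χ j σ G ξ - lowDensity χ' k σ G ξ) x * 𝓕 (Φ : ℝ → ℂ) x) := by
      simp only [hb]
      rw [← integral_sub (hint hχ j) (hint hχ' k)]
      congr 1 with x
      have : 𝓕⁻ (fun ξ => lowDensity χ j σ G ξ - lowDensity χ' k σ G ξ) x =
          𝓕⁻ (lowDensity χ j σ G) x - 𝓕⁻ (lowDensity χ' k σ G) x := by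
        simp only [fourierInv_eq_chr, mul_sub]
        exact integral_sub (integrable_chr_mul i₁ x) (integrable_chr_mul i₂ x)
      rw [this, SchwartzMap.fourier_coe]
      ring
    rw [edist_eq_enorm_sub, hsub]
    refine (hC f B hf hB (fun ξ => lowDensity χ j σ G ξ - lowDensity χ' k σ G ξ)
      ((measurable_lowDensity hχ j σ G).sub (measurable_lowDensity hχ' k σ G))
      (i₁.sub i₂) ((memLp_lowDensity hχ j σ G).sub (memLp_lowDensity hχ' k σ G)) (max N₁ N₂)
      (fun η hη => by
        rw [h₁ _ (le_max_left _ _) η hη, h₂ _ (le_max_right _ _) η hη, sub_zero]) Φ).trans ?_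
    have e : (fun ξ => ENNReal.ofReal (wt σ ξ) * ‖lowDensity χ j σ G ξ - lowDensity χ' k σ G ξ‖ₑ) =
        fun ξ => ‖((χ ((2 ^ j : ℝ)⁻¹ * ξ) - 1 : ℝ) : ℂ) * G ξ -
          ((χ' ((2 ^ k : ℝ)⁻¹ * ξ) - 1 : ℝ) : ℂ) * G ξ‖ₑ := by
      ext ξ
      rw [lowDensity, lowDensity, ← sub_mul, cancel]
      congr 1
      push_cast
      ring
    have tri := eLpNorm_sub_le (p := 2) (measurable_truncError hχ j G).aestronglyMeasurable
      (measurable_truncError hχ' k G).aestronglyMeasurable (by norm_num) (μ := volume)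
    rw [e]
    change _ * _ * (l2 _ * N) ≤ _
    rw [← eLpNorm_two_eq_l2]
    calc _ ≤ C * ENNReal.ofReal B * ((truncError χ j G + truncError χ' k G) * N) := by
          gcongr
          exact tri
      _ = _ := by ring
  have hKe : ∀ {χ : ℝ → ℝ}, IsCutoff χ →
      Tendsto (fun j => C * ENNReal.ofReal B * N * truncError χ j G) atTop (𝓝 0) := by
    intro χ hχ
    have := ENNReal.Tendsto.const_mul (a := C * ENNReal.ofReal B * N) (tendsto_truncError hχ G)
      (Or.inr (by finiteness))
    rwa [mul_zero] at this
  have hcauchy : CauchySeq (b χ₀) := by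
    rw [EMetric.cauchySeq_iff]
    intro ε hε
    obtain ⟨n, hn⟩ := eventually_atTop.1
      ((hKe hχ₀).eventually (gt_mem_nhds (ENNReal.half_pos hε.ne')))
    refine ⟨n, fun j hj k hk => (hdiff hχ₀ hχ₀ j k).trans_lt ?_⟩
    rw [← ENNReal.add_halves ε]
    exact ENNReal.add_lt_add (hn j hj) (hn k hk)
  obtain ⟨ℓ, hℓ⟩ := cauchySeq_tendsto_of_complete hcauchy
  refine ⟨ℓ, ?_, fun χ hχ => ?_⟩
  · refine le_of_tendsto ((continuous_enorm.tendsto _).comp hℓ) (Eventually.of_forall fun j => ?_)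
    obtain ⟨N₁, h₁⟩ := exists_nat_lowDensity_eq_zero hχ₀ j σ G
    refine (hC f B hf hB _ (measurable_lowDensity hχ₀ j σ G) (integrable_lowDensity hχ₀ j σ G)
      (memLp_lowDensity hχ₀ j σ G) N₁ (h₁ N₁ le_rfl) Φ).trans ?_
    have hl : l2 (fun x => ENNReal.ofReal (wt σ x) * ‖lowDensity χ₀ j σ G x‖ₑ) ≤
        ENNReal.ofReal D * ‖G‖ₑ := by
      rw [enorm_Lp_eq_l2, ← l2_const_mul ENNReal.ofReal_ne_top]
      refine l2_mono fun x => ?_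
      rw [lowDensity, cancel, enorm_mul, ← ofReal_norm ((χ₀ _ : ℝ) : ℂ), Complex.norm_real]
      gcongr
      exact hDb _
    calc _ ≤ C * ENNReal.ofReal B * (ENNReal.ofReal D * ‖G‖ₑ * N) := by gcongr
      _ = _ := by
        push_cast
        change _ = C * ENNReal.ofReal D * _
        ring
  · have h0 : Tendsto (fun j => edist (b χ j) (b χ₀ j)) atTop (𝓝 0) := by
      have := (hKe hχ).add (hKe hχ₀)
      rw [add_zero] at this
      exact tendsto_of_tendsto_of_tendsto_of_le_of_le tendsto_const_nhds this
        (fun _ => zero_le) fun j => hdiff hχ hχ₀ j j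
    have h1 : Tendsto (fun j => b χ j - b χ₀ j) atTop (𝓝 0) := by
      rw [tendsto_iff_edist_tendsto_0]
      simpa [edist_eq_enorm_sub] using h0
    simpa using h1.add hℓ

/-! ### Representatives of finite norm, and vanishing norms -/

/-- With at most one representative, the infima defining the norms are attained as soon as they are
finite. -/
theorem toTemperedDistribution_injective {p : ℝ≥0∞} [Fact (1 ≤ p)]
    {u v : Lp ℂ p (volume : Measure ℝ)} (h : (u : 𝓢'(ℝ, ℂ)) = (v : 𝓢'(ℝ, ℂ))) : u = v :=
  LinearMap.ker_eq_bot.1 (Lp.ker_toTemperedDistributionCLM_eq_bot (F := ℂ) (p := p)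
    (μ := (volume : Measure ℝ))) h

theorem exists_of_supNorm_lt_top {f : 𝓢'(ℝ, ℂ)} (h : supNorm f < ⊤) :
    ∃ u : Lp ℂ ∞ (volume : Measure ℝ), f = (u : 𝓢'(ℝ, ℂ)) ∧ supNorm f = ‖u‖ₑ := by
  obtain ⟨u, hu⟩ := iInf_lt_iff.1 h
  obtain ⟨hfu, -⟩ := iInf_lt_iff.1 hu
  refine ⟨u, hfu, le_antisymm (iInf₂_le u hfu) (le_iInf₂ fun v hv => ?_)⟩
  rw [toTemperedDistribution_injective (hfu.symm.trans hv)]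

theorem exists_of_sobolevNorm_lt_top {σ : ℝ} {f : 𝓢'(ℝ, ℂ)} (h : sobolevNorm σ f < ⊤) :
    ∃ u : Lp ℂ 2 (volume : Measure ℝ),
      TemperedDistribution.smulLeftCLM ℂ (weight σ) (𝓕 f) = (u : 𝓢'(ℝ, ℂ)) ∧
        sobolevNorm σ f = ‖u‖ₑ := by
  obtain ⟨u, hu⟩ := iInf_lt_iff.1 h
  obtain ⟨hfu, -⟩ := iInf_lt_iff.1 hu
  refine ⟨u, hfu, le_antisymm (iInf₂_le u hfu) (le_iInf₂ fun v hv => ?_)⟩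
  rw [toTemperedDistribution_injective (hfu.symm.trans hv)]

theorem ae_norm_le_norm (u : Lp ℂ ∞ (volume : Measure ℝ)) : ∀ᵐ x, ‖u x‖ ≤ ‖u‖ := by
  filter_upwards [ae_le_eLpNormEssSup (f := u) (μ := volume)] with x hx
  rw [← eLpNorm_exponent_top, ← Lp.enorm_def, ← ofReal_norm, ← ofReal_norm] at hx
  exact (ENNReal.ofReal_le_ofReal_iff (norm_nonneg _)).1 hx

theorem sobolevNorm_zero (σ : ℝ) : sobolevNorm σ 0 = 0 := by
  refine le_antisymm ((iInf₂_le 0 ?_).trans_eq (by simp)) zero_le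
  rw [FourierTransform.fourier_zero, map_zero]
  exact (map_zero (Lp.toTemperedDistributionCLM ℂ (volume : Measure ℝ) 2)).symm

theorem eq_zero_of_supNorm_eq_zero {f : 𝓢'(ℝ, ℂ)} (h : supNorm f = 0) : f = 0 := by
  obtain ⟨u, hu, hn⟩ := exists_of_supNorm_lt_top (h ▸ ENNReal.zero_lt_top)
  rw [h, eq_comm, enorm_eq_zero] at hn
  rw [hu, hn]
  exact map_zero (Lp.toTemperedDistributionCLM ℂ (volume : Measure ℝ) ∞)

theorem eq_zero_of_sobolevNorm_eq_zero {σ : ℝ} {f : 𝓢'(ℝ, ℂ)} (h : sobolevNorm σ f = 0) :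
    f = 0 := by
  obtain ⟨u, hu, hn⟩ := exists_of_sobolevNorm_lt_top (h ▸ ENNReal.zero_lt_top)
  rw [h, eq_comm, enorm_eq_zero] at hn
  ext φ
  rw [← FourierTransform.fourier_fourierInv_eq (F := 𝓢(ℝ, ℂ)) φ, ← TemperedDistribution.fourier_apply,
    apply_eq_integral_of_smulLeftCLM_eq hu]
  have : ∀ᵐ ξ, u ξ = 0 := by
    rw [hn]
    exact Lp.coeFn_zero _ _ _
  refine integral_eq_zero_of_ae ?_
  filter_upwards [this] with ξ hξ
  simp [hξ]

theorem isProduct_zero_left (g : 𝓢'(ℝ, ℂ)) : IsProduct 0 g 0 := by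
  intro χ hχ φ
  simp [lowFreq_eq, FourierTransform.fourier_zero]

theorem isProduct_zero_right (f : 𝓢'(ℝ, ℂ)) : IsProduct f 0 0 := by
  intro χ hχ φ
  simp [lowFreq_eq, FourierTransform.fourier_zero]

/-- The radius one matches the enlargement of a unit band by one on each side. -/
theorem exists_isCutoff_supported : ∃ χ : ℝ → ℝ, IsCutoff χ ∧ ∀ ξ, 1 ≤ |ξ| → χ ξ = 0 := by
  let b : ContDiffBump (0 : ℝ) := ⟨1 / 2, 1, by norm_num, by norm_num⟩
  refine ⟨b, ⟨b.contDiff, b.hasCompactSupport, b.eventuallyEq_one⟩, fun ξ hξ => ?_⟩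
  apply b.zero_of_le_dist
  rwa [Real.dist_eq, sub_zero]

/-! ### Assembling the product -/

/-- A pointwise limit of linear functionals that satisfies a Sobolev bound is a distribution of
the corresponding Sobolev class. -/
theorem exists_distribution_of_limit {σ : ℝ} (M : ℝ≥0) (B : ℕ → 𝓢(ℝ, ℂ) →ₗ[ℂ] ℂ)
    (ℓ : 𝓢(ℝ, ℂ) → ℂ) (hℓ : ∀ φ, Tendsto (fun j => B j φ) atTop (𝓝 (ℓ φ)))
    (hM : ∀ Φ : 𝓢(ℝ, ℂ), ‖ℓ (𝓕 Φ)‖ₑ ≤ M * l2 fun x => ENNReal.ofReal (wt (-σ) x) * ‖Φ x‖ₑ) :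
    ∃ h : 𝓢'(ℝ, ℂ), (∀ φ, h φ = ℓ φ) ∧ sobolevNorm σ h ≤ M :=
  -- Only linearity is inherited from the approximations; continuity of the limit comes from the
  -- Sobolev bound.
  exists_sobolevNorm_le_of_bound (linearMapOfTendsto ℓ B (tendsto_pi_nhds.2 hℓ)) M hM

/-- The product of `f` and `g ∈ H^σ` exists and is bounded, for `|σ| ≤ s`. -/
theorem exists_product_bound {s σ : ℝ} (hs : 1 / 2 < s) (hσ : |σ| ≤ s) :
    ∃ C : ℝ≥0, ∀ f g : 𝓢'(ℝ, ℂ), supNorm f < ⊤ →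
      sobolevNorm (s - 1) (TemperedDistribution.derivCLM ℂ f) < ⊤ → sobolevNorm σ g < ⊤ →
      ∃ h : 𝓢'(ℝ, ℂ), IsProduct f g h ∧ sobolevNorm σ h ≤ C * sobolevNorm σ g *
        (supNorm f + sobolevNorm (s - 1) (TemperedDistribution.derivCLM ℂ f)) := by
  obtain ⟨χ₀, hχ₀, hsupp⟩ := exists_isCutoff_supported
  obtain ⟨C₁, h₁⟩ := exists_low_limit σ hχ₀ hsupp
  obtain ⟨C₂, h₂⟩ := exists_high_limit hs hσ hχ₀
  refine ⟨C₁ + C₂, fun f g hf hf' hg => ?_⟩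
  obtain ⟨u, rfl, hun⟩ := exists_of_supNorm_lt_top hf
  obtain ⟨F, hF, hFn⟩ := exists_of_sobolevNorm_lt_top hf'
  obtain ⟨G, hG, hGn⟩ := exists_of_sobolevNorm_lt_top hg
  rw [hun, hFn, hGn]
  have hub := ae_norm_le_norm u
  have hum := Lp.aestronglyMeasurable u
  set f : 𝓢'(ℝ, ℂ) := (u : 𝓢'(ℝ, ℂ))
  -- The first summand involves neither `χ` nor `j`, so only the second has to be followed in the
  -- limit.
  have efreq : ∀ {χ : ℝ → ℝ} (hχ : IsCutoff χ) (j : ℕ) (x : ℝ), lowFreq hχ j f x =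
      lowPass (hχ₀.kernel 0 0) u x + 𝓕⁻ (highDensity χ χ₀ j (s - 1) F) x := by
    intro χ hχ j x
    rw [lowFreq_eq_add_fourierInv hχ hχ₀ j hF, lowFreq_eq_lowPass]
    rfl
  have egreq : ∀ {χ : ℝ → ℝ} (hχ : IsCutoff χ) (j : ℕ) (x : ℝ), lowFreq hχ j g x =
      𝓕⁻ (lowDensity χ j σ G) x := fun hχ j x => lowFreq_eq_fourierInv hχ j hG x
  have mlow := aestronglyMeasurable_lowPass (hχ₀.kernel 0 0) hum
  have bg : ∀ {χ : ℝ → ℝ}, IsCutoff χ → ∀ (j : ℕ) (φ : 𝓢(ℝ, ℂ)),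
      Integrable fun x => 𝓕⁻ (lowDensity χ j σ G) x * φ x := fun hχ j φ =>
    integrable_bdd_mul_schwartz
      (continuous_fourierInv (integrable_lowDensity hχ j σ G)).aestronglyMeasurable
      (norm_fourierInv_le _) φ
  have i₁ : ∀ {χ : ℝ → ℝ}, IsCutoff χ → ∀ (j : ℕ) (φ : 𝓢(ℝ, ℂ)), Integrable fun x =>
      lowPass (hχ₀.kernel 0 0) u x * (𝓕⁻ (lowDensity χ j σ G) x * φ x) := fun hχ j φ =>
    (bg hχ j φ).bdd_mul mlow (ae_of_all _ (norm_lowPass_le _ hub))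
  have i₂ : ∀ {χ : ℝ → ℝ}, IsCutoff χ → ∀ (j : ℕ) (φ : 𝓢(ℝ, ℂ)), Integrable fun x =>
      𝓕⁻ (highDensity χ χ₀ j (s - 1) F) x * (𝓕⁻ (lowDensity χ j σ G) x * φ x) := fun hχ j φ =>
    (bg hχ j φ).bdd_mul
      (continuous_fourierInv (integrable_highDensity hχ hχ₀ j _ F)).aestronglyMeasurable
      (ae_of_all _ (norm_fourierInv_le _))
  have split : ∀ {χ : ℝ → ℝ} (hχ : IsCutoff χ) (j : ℕ) (φ : 𝓢(ℝ, ℂ)) (x : ℝ),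
      lowFreq hχ j f x * lowFreq hχ j g x * φ x =
        lowPass (hχ₀.kernel 0 0) u x * (𝓕⁻ (lowDensity χ j σ G) x * φ x) +
        𝓕⁻ (highDensity χ χ₀ j (s - 1) F) x * (𝓕⁻ (lowDensity χ j σ G) x * φ x) := by
    intro χ hχ j φ x
    rw [efreq, egreq]
    ring
  have itot : ∀ {χ : ℝ → ℝ} (hχ : IsCutoff χ) (j : ℕ) (φ : 𝓢(ℝ, ℂ)), Integrable fun x =>
      lowFreq hχ j f x * lowFreq hχ j g x * φ x := by
    intro χ hχ j φ
    simp_rw [split]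
    exact (i₁ hχ j φ).add (i₂ hχ j φ)
  choose ℓ₁ hb₁ hl₁ using h₁ u ‖u‖ hum hub G
  choose ℓ₂ hb₂ hl₂ using h₂ F G
  set ℓ : 𝓢(ℝ, ℂ) → ℂ := fun φ => ℓ₁ (𝓕⁻ φ) + ℓ₂ (𝓕⁻ φ) with hℓ
  have hlim : ∀ {χ : ℝ → ℝ} (hχ : IsCutoff χ) (φ : 𝓢(ℝ, ℂ)), Tendsto (fun j : ℕ =>
      ∫ x, lowFreq hχ j f x * lowFreq hχ j g x * φ x) atTop (𝓝 (ℓ φ)) := by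
    intro χ hχ φ
    have t := (hl₁ (𝓕⁻ φ) χ hχ).add (hl₂ (𝓕⁻ φ) χ hχ)
    rw [FourierTransform.fourier_fourierInv_eq] at t
    refine t.congr fun j => ?_
    simp_rw [split]
    exact (integral_add (i₁ hχ j φ) (i₂ hχ j φ)).symm
  set M : ℝ≥0 := (C₁ + C₂) * ‖G‖₊ * (‖u‖₊ + ‖F‖₊) with hM
  set B : ℕ → 𝓢(ℝ, ℂ) →ₗ[ℂ] ℂ := fun j =>
    { toFun := fun φ => ∫ x, lowFreq hχ₀ j f x * lowFreq hχ₀ j g x * φ x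
      map_add' := fun φ ψ => by
        rw [← integral_add (itot hχ₀ j φ) (itot hχ₀ j ψ)]
        congr 1 with x
        rw [add_apply]
        ring
      map_smul' := fun c φ => by
        rw [RingHom.id_apply, smul_eq_mul, ← integral_const_mul]
        congr 1 with x
        rw [smul_apply, smul_eq_mul]
        ring } with hB
  obtain ⟨h, hh, hn⟩ := exists_distribution_of_limit (σ := σ) M B ℓ (fun φ => hlim hχ₀ φ) fun Φ => by
    simp only [hℓ]
    rw [FourierTransform.fourierInv_fourier_eq]
    refine (enorm_add_le _ _).trans ((add_le_add (hb₁ Φ) (hb₂ Φ)).trans ?_)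
    rw [ofReal_norm]
    set N := l2 fun x => ENNReal.ofReal (wt (-σ) x) * ‖Φ x‖ₑ
    have e : ((M : ℝ≥0) : ℝ≥0∞) = (C₁ + C₂) * ‖G‖ₑ * (‖u‖ₑ + ‖F‖ₑ) := by
      rw [hM]
      push_cast
      rfl
    rw [e]
    -- The cross terms are added so that the sum factorises.
    calc _ ≤ C₁ * (‖u‖ₑ * ‖G‖ₑ * N) + C₂ * (‖F‖ₑ * ‖G‖ₑ * N) +
          (C₂ * (‖u‖ₑ * ‖G‖ₑ * N) + C₁ * (‖F‖ₑ * ‖G‖ₑ * N)) := le_self_add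
      _ = _ := by ring
  refine ⟨h, fun χ hχ φ => ?_, hn.trans_eq ?_⟩
  · rw [hh]
    exact hlim hχ φ
  · rw [hM]
    push_cast
    rfl

/-- The product estimate in all cases, including those where norms vanish or are infinite. -/
theorem exists_product_le {s σ : ℝ} (hs : 1 / 2 < s) (hσ : |σ| ≤ s) :
    ∃ C : ℝ≥0, ∀ f g : 𝓢'(ℝ, ℂ),
      (supNorm f < ⊤ → sobolevNorm (s - 1) (TemperedDistribution.derivCLM ℂ f) < ⊤ →
        sobolevNorm σ g < ⊤ → ∃ h : 𝓢'(ℝ, ℂ), IsProduct f g h) ∧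
      ∀ h : 𝓢'(ℝ, ℂ), IsProduct f g h → sobolevNorm σ h ≤ C * sobolevNorm σ g *
        (supNorm f + sobolevNorm (s - 1) (TemperedDistribution.derivCLM ℂ f)) := by
  obtain ⟨C, hC⟩ := exists_product_bound hs hσ
  -- A nonzero constant makes the right-hand side infinite when one norm is infinite and the other
  -- factor is nonzero.
  refine ⟨C + 1, fun f g => ⟨fun h1 h2 h3 => ?_, fun h hh => ?_⟩⟩
  · obtain ⟨h, hh, -⟩ := hC f g h1 h2 h3
    exact ⟨h, hh⟩
  set N := supNorm f + sobolevNorm (s - 1) (TemperedDistribution.derivCLM ℂ f) with hN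
  -- By `0 · ∞ = 0` the right-hand side vanishes here even if the other factor is infinite; a
  -- vanishing norm forces the distribution, hence the product, to be zero.
  by_cases hg0 : sobolevNorm σ g = 0
  · obtain rfl := eq_zero_of_sobolevNorm_eq_zero hg0
    rw [hh.unique (isProduct_zero_right f), sobolevNorm_zero]
    exact zero_le
  by_cases hN0 : N = 0
  · obtain rfl := eq_zero_of_supNorm_eq_zero (add_eq_zero.1 hN0).1
    rw [hh.unique (isProduct_zero_left g), sobolevNorm_zero]
    exact zero_le
  have hC0 : ((C + 1 : ℝ≥0) : ℝ≥0∞) ≠ 0 := by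
    rw [ENNReal.coe_ne_zero]; positivity
  by_cases hgt : sobolevNorm σ g = ⊤
  · rw [hgt, ENNReal.mul_top hC0, ENNReal.top_mul hN0]
    exact le_top
  by_cases hNt : N = ⊤
  · rw [hNt, ENNReal.mul_top (mul_ne_zero hC0 hg0)]
    exact le_top
  have hlt := ENNReal.add_lt_top.1 (lt_top_iff_ne_top.2 hNt)
  obtain ⟨h', hh', hb⟩ := hC f g hlt.1 hlt.2 (lt_top_iff_ne_top.2 hgt)
  rw [hh.unique hh']
  refine hb.trans ?_
  gcongr
  exact le_self_add

end ProductEstimate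

end

theorem lemma2p2 (s : ℝ) (hs : 1 / 2 < s) :
    ∃ C : ℝ≥0, ∀ f g : 𝓢'(ℝ, ℂ),
      (ProductEstimate.supNorm f < ⊤ →
        ProductEstimate.sobolevNorm (s - 1) (TemperedDistribution.derivCLM ℂ f) < ⊤ →
        (ProductEstimate.sobolevNorm s g < ⊤ ∨ ProductEstimate.sobolevNorm (s - 1) g < ⊤) →
        ∃ h : 𝓢'(ℝ, ℂ), ProductEstimate.IsProduct f g h) ∧
      ∀ h : 𝓢'(ℝ, ℂ), ProductEstimate.IsProduct f g h →
        ProductEstimate.sobolevNorm s h ≤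
            C * ProductEstimate.sobolevNorm s g *
              (ProductEstimate.supNorm f +
                ProductEstimate.sobolevNorm (s - 1) (TemperedDistribution.derivCLM ℂ f)) ∧
          ProductEstimate.sobolevNorm (s - 1) h ≤
            C * ProductEstimate.sobolevNorm (s - 1) g *
              (ProductEstimate.supNorm f +
                ProductEstimate.sobolevNorm (s - 1) (TemperedDistribution.derivCLM ℂ f)) := by
  obtain ⟨C₁, h₁⟩ := ProductEstimate.exists_product_le hs (abs_of_nonneg (by linarith)).le
  -- The condition `|s - 1| ≤ s` amounts to `s ≥ 1/2`.
  obtain ⟨C₂, h₂⟩ := ProductEstimate.exists_product_le (σ := s - 1) hs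
    (abs_le.2 ⟨by linarith, by linarith⟩)
  refine ⟨C₁ + C₂, fun f g => ⟨fun hf hf' hg => ?_, fun h hh => ⟨?_, ?_⟩⟩⟩
  · rcases hg with hg | hg
    · exact (h₁ f g).1 hf hf' hg
    · exact (h₂ f g).1 hf hf' hg
  · refine ((h₁ f g).2 h hh).trans ?_
    gcongr
    exact le_self_add
  · refine ((h₂ f g).2 h hh).trans ?_
    gcongr
    exact le_add_self
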